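/- Let $m,n,s,k\ge 0$ and let $t\ge 1$ be an integer dividing $2nk$; put $v=2nk+t$ and let $J=\frac{v}{t}\mathbb{Z}_v$ be the subgroup of $\mathbb{Z}_v$ of order $t$. A relative Heffter array $H_t(m,n;s,k)$ is an $m\times n$ array, some of whose cells may be empty, with entries in $\mathbb{Z}_v$ such that (a) every row contains exactly $s$ filled cells and every column contains exactly $k$ filled cells; (b) for every $x\in\mathbb{Z}_v\setminus J$, either $x$ or $-x$ appears in the array; (c) the entries of every row and of every column sum to $0$ in $\mathbb{Z}_v$. It is called integer if, when its entries are represented by integers in $\pm\{1,\dots,\lfloor v/2\rfloor\}$, every row and every column sums to $0$ in $\mathbb{Z}$. A square array $H_t(n,n;k,k)$ is denoted by $H_t(n;k)$. Theorem. Let $3\le k\le n$ with $k\ne 5$. There exists an integer relative Heffter array $H_k(n;k)$ if and only if one of the following holds: - $k$ is odd and $n\equiv 0,3\pmod 4$; - $k\equiv 2\pmod 4$ and $n$ is even; - $k\equiv 0\pmod 4$. Furthermore, for $n\ge 5$ there exists an integer $H_5(n;5)$ if $n\equiv 3\pmod 4$; and no integer $H_5(n;5)$ exists if $n\equiv 1,2\pmod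 4$. -/

import Mathlib

/-- An `m × n` partially filled array on `Ω`; `none` marks an empty cell. -/
abbrev PFArray (m n : ℕ) (Ω : Type) : Type := Fin m → Fin n → Option Ω

namespace PFArray

/-- The number of filled cells of row `i`. -/
def rowCount {m n : ℕ} {Ω : Type} (A : PFArray m n Ω) (i : Fin m) : ℕ :=
  (Finset.univ.filter fun j : Fin n => (A i j).isSome).card

/-- The number of filled cells of column `j`. -/
def colCount {m n : ℕ} {Ω : Type} (A : PFArray m n Ω) (j : Fin n) : ℕ :=
  (Finset.univ.filter fun i : Fin m => (A i j).isSome).card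

/-- The sum of the entries of row `i` (empty cells contribute nothing). -/
def rowSum {m n : ℕ} {Ω : Type} [AddCommMonoid Ω] (A : PFArray m n Ω) (i : Fin m) : Ω :=
  ∑ j : Fin n, (A i j).getD 0

/-- The sum of the entries of column `j` (empty cells contribute nothing). -/
def colSum {m n : ℕ} {Ω : Type} [AddCommMonoid Ω] (A : PFArray m n Ω) (j : Fin n) : Ω :=
  ∑ i : Fin m, (A i j).getD 0

/-- `x` is the content of some filled cell of `A`. -/
def Appears {m n : ℕ} {Ω : Type} (A : PFArray m n Ω) (x : Ω) : Prop :=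
  ∃ (i : Fin m) (j : Fin n), A i j = some x

/-- The array of residues modulo `v` of an array of integers, with the same filled cells. -/
def toZMod {m n : ℕ} (v : ℕ) (A : PFArray m n ℤ) : PFArray m n (ZMod v) :=
  fun i j => (A i j).map fun a : ℤ => (a : ZMod v)

end PFArray

/-- The subgroup `(v / t) ℤ_v` of `ℤ_v`; when `t` divides `v > 0` it is the unique subgroup of
order `t`, see `card_subgroupOfOrder` and `eq_subgroupOfOrder`. -/
def subgroupOfOrder (v t : ℕ) : AddSubgroup (ZMod v) :=
  AddSubgroup.zmultiples ((v / t : ℕ) : ZMod v)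

theorem card_subgroupOfOrder {v t : ℕ} (hv : 0 < v) (ht : t ∣ v) :
    Nat.card (subgroupOfOrder v t) = t := by
  obtain ⟨d, rfl⟩ := ht
  have ht0 : 0 < t := Nat.pos_of_mul_pos_right hv
  have hd0 : 0 < d := Nat.pos_of_mul_pos_left hv
  rw [subgroupOfOrder, Nat.card_zmultiples, Nat.mul_div_cancel_left d ht0,
    ZMod.addOrderOf_coe d hv.ne', Nat.gcd_mul_left_left, Nat.mul_div_cancel t hd0]

theorem eq_subgroupOfOrder {v t : ℕ} (hv : 0 < v) (ht : t ∣ v) (J : AddSubgroup (ZMod v))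
    (hJ : Nat.card J = t) : J = subgroupOfOrder v t := by
  have : NeZero v := ⟨hv.ne'⟩
  refine AddSubgroup.eq_of_le_of_card_ge (fun x hx => ?_)
    ((card_subgroupOfOrder hv ht).trans hJ.symm).le
  obtain ⟨d, rfl⟩ := ht
  have ht0 : 0 < t := Nat.pos_of_mul_pos_right hv
  have h1 : Nat.card J • (⟨x, hx⟩ : J) = 0 := card_nsmul_eq_zero'
  have h2 : t • x = 0 := by
    rw [hJ] at h1
    simpa using congrArg Subtype.val h1
  have h3 : ((t * x.val : ℕ) : ZMod (t * d)) = 0 := by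
    rw [Nat.cast_mul, ZMod.natCast_zmod_val, ← nsmul_eq_mul, h2]
  obtain ⟨c, hc⟩ := Nat.dvd_of_mul_dvd_mul_left ht0 ((ZMod.natCast_eq_zero_iff _ _).1 h3)
  rw [subgroupOfOrder, Nat.mul_div_cancel_left d ht0]
  refine AddSubgroup.mem_zmultiples_iff.2 ⟨c, ?_⟩
  rw [← ZMod.natCast_zmod_val x, hc, natCast_zsmul, nsmul_eq_mul, Nat.cast_mul]
  exact mul_comm _ _

/-- `A` is a Heffter array `H_t(m, n; s, k)` over `ℤ_v` relative to the subgroup `J` of `ℤ_v` of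
order `t`, where `v = 2nk + t`. -/
structure IsRelativeHeffter (t m n s k : ℕ) (A : PFArray m n (ZMod (2 * n * k + t))) : Prop where
  pos : 0 < 2 * n * k + t
  dvd : t ∣ 2 * n * k
  row_count : ∀ i, A.rowCount i = s
  col_count : ∀ j, A.colCount j = k
  covers : ∀ x : ZMod (2 * n * k + t), x ∉ subgroupOfOrder (2 * n * k + t) t →
    A.Appears x ∨ A.Appears (-x)
  row_sum : ∀ i, A.rowSum i = 0
  col_sum : ∀ j, A.colSum j = 0

/-- `A` is an integer relative Heffter array `H_t(m, n; s, k)`, written with the representatives of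
its entries in `±{1, …, ⌊(2nk + t) / 2⌋}`: modulo `2nk + t` it is an `H_t(m, n; s, k)`, and its
rows and columns sum to zero in `ℤ`. -/
structure IsIntegerRelativeHeffter (t m n s k : ℕ) (A : PFArray m n ℤ) : Prop where
  isRelativeHeffter : IsRelativeHeffter t m n s k (A.toZMod (2 * n * k + t))
  entry_mem : ∀ a : ℤ, A.Appears a → 1 ≤ |a| ∧ |a| ≤ (((2 * n * k + t) / 2 : ℕ) : ℤ)
  row_sum : ∀ i, A.rowSum i = 0
  col_sum : ∀ j, A.colSum j = 0

/-- There exists an integer square relative Heffter array `H_t(n; k)`. -/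
def ExistsIntegerHeffter (t n k : ℕ) : Prop :=
  ∃ A : PFArray n n ℤ, IsIntegerRelativeHeffter t n n k k A

/-! Here v = k(2n+1) and J consists of the multiples of 2n+1. So the entries must, up to sign, cover
the integers up to v/2 not divisible by 2n+1. These form k half blocks of n consecutive integers, as
many numbers as there are filled cells, so each occurs exactly once up to sign.

Necessity is a parity argument. The entries add up to 0 and |a| ≡ a mod 2, so the sum of the half
blocks is even (`even_halvesSum`). A pair of half blocks making up a full block has sum ≡ n mod 2.
For k ≡ 2 mod 4 this forces n even; for odd k it forces n(n+1)/2 even.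

Sufficiency comes from filling k pairwise disjoint diagonals in groups, each group having zero row
and column sums and using up its own half blocks (`Realizes.append`). Four diagonals can always be
added, so only a base group is needed for each residue of k mod 4: - 4 ∣ k: the empty group; - k ≡
3: three diagonals from a labelling of an n-cycle (`IsSumLabelling.realizes`); - k ≡ 1 and n ≡ 3:
five diagonals from a pair of labellings (`IsSumLabellingPair.realizes`); - k ≡ 2 and n even: six
diagonals made of 2 × 2 blocks (`realizes_blockPerm_six`); - k ≡ 1 and n ≡ 0: three diagonals along
a cycle and six of 2 × 2 blocks. This base has nine diagonals, so it does not reach k = 5. -/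

/-! ### Half blocks: the integers that are not multiples of 2n+1. -/

/-- The first element of the `j`-th half block: the `2 n + 1`-blocks `{1, …, 2 n} + (2 n + 1) ℕ` are
cut into two intervals of length `n`. -/
def halfStart (n j : ℕ) : ℕ := (j / 2) * (2 * n + 1) + (j % 2) * n + 1

/-- The union of the half blocks whose index lies in `J`. -/
def halves (n : ℕ) (J : Set ℕ) : Set ℕ := {a | ∃ j ∈ J, ∃ v < n, a = halfStart n j + v}

theorem halves_union (n : ℕ) (J K : Set ℕ) : halves n (J ∪ K) = halves n J ∪ halves n K := by
  ext a
  simp only [halves, Set.mem_union, Set.mem_ofPred_eq]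
  constructor
  · rintro ⟨j, hj | hj, v, hv⟩
    · exact Or.inl ⟨j, hj, v, hv⟩
    · exact Or.inr ⟨j, hj, v, hv⟩
  · rintro (⟨j, hj, v, hv⟩ | ⟨j, hj, v, hv⟩)
    · exact ⟨j, Or.inl hj, v, hv⟩
    · exact ⟨j, Or.inr hj, v, hv⟩

theorem pos_of_mem_halves {n : ℕ} {J : Set ℕ} {a : ℕ} (h : a ∈ halves n J) : 1 ≤ a := by
  obtain ⟨j, -, v, -, rfl⟩ := h
  unfold halfStart
  omega

theorem le_of_mem_halves {n k a : ℕ} (h : a ∈ halves n (Set.Iio k)) :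
    a ≤ (2 * n * k + k) / 2 := by
  obtain ⟨j, hj, v, hv, rfl⟩ := h
  rw [Set.mem_Iio] at hj
  rw [Nat.le_div_iff_mul_le two_pos]
  unfold halfStart
  have h1 := Nat.div_add_mod j 2
  have h2 : j % 2 < 2 := Nat.mod_lt _ two_pos
  generalize j / 2 = q at *
  generalize j % 2 = r at *
  obtain rfl | rfl : r = 0 ∨ r = 1 := by omega
  · nlinarith [Nat.mul_le_mul_left (2 * n + 1) (show 2 * q + 1 ≤ k by omega)]
  · nlinarith [Nat.mul_le_mul_left (2 * n + 1) (show 2 * q + 2 ≤ k by omega)]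

/-- For a = q(2n+1) + r with r ≠ 0, the half block has index 2q or 2q+1 according to whether r ≤ n.
The bound k(2n+1)/2 is reached at the end of half block k-1 (k odd) or at the multiple of 2n+1 right
after it (k even). -/
theorem mem_halves {n k a : ℕ} (h : a ≤ (2 * n * k + k) / 2) (hd : ¬ (2 * n + 1) ∣ a) :
    a ∈ halves n (Set.Iio k) := by
  rw [Nat.le_div_iff_mul_le two_pos] at h
  have h1 := Nat.div_add_mod a (2 * n + 1)
  have h2 : a % (2 * n + 1) < 2 * n + 1 := Nat.mod_lt _ (by omega)
  have h3 : a % (2 * n + 1) ≠ 0 := fun h0 => hd (Nat.dvd_of_mod_eq_zero h0)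
  set q := a / (2 * n + 1)
  generalize a % (2 * n + 1) = r at *
  rcases le_or_gt r n with hr | hr
  · refine ⟨2 * q, ?_, r - 1, by omega, ?_⟩
    · rw [Set.mem_Iio]
      by_contra hk
      nlinarith [Nat.mul_le_mul_left (2 * n + 1) (show k ≤ 2 * q by omega),
        Nat.pos_of_ne_zero h3]
    · have e1 : 2 * q / 2 = q := by omega
      have e2 : 2 * q % 2 = 0 := by omega
      rw [halfStart, e1, e2, ← h1, mul_comm q]
      omega
  · refine ⟨2 * q + 1, ?_, r - 1 - n, by omega, ?_⟩
    · rw [Set.mem_Iio]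
      by_contra hk
      nlinarith [Nat.mul_le_mul_left (2 * n + 1) (show k ≤ 2 * q + 1 by omega)]
    · have e1 : (2 * q + 1) / 2 = q := by omega
      have e2 : (2 * q + 1) % 2 = 1 := by omega
      rw [halfStart, e1, e2, ← h1, mul_comm q]
      omega

theorem not_dvd_of_mem_halves {n : ℕ} {J : Set ℕ} {a : ℕ} (h : a ∈ halves n J) :
    ¬ (2 * n + 1) ∣ a := by
  obtain ⟨j, -, v, hv, rfl⟩ := h
  have h2 : j % 2 < 2 := Nat.mod_lt _ two_pos
  rw [halfStart, add_assoc, add_assoc, Nat.dvd_add_right (dvd_mul_left _ _)]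
  intro h
  have := Nat.le_of_dvd (by omega) h
  obtain h0 | h0 : j % 2 = 0 ∨ j % 2 = 1 := by omega
  all_goals rw [h0] at this; omega

/-! ### Fillings of families of diagonals. -/

/-- There are `k` diagonals, given by the permutations `σ 0, …, σ (k - 1)` and filled with integers
such that all rows and columns have sum zero and the absolute values of the entries form `S`. -/
def Realizes {ι : Type} (k : ℕ) (σ : ℕ → Equiv.Perm ι) (S : Set ℕ) : Prop :=
  ∃ e : ℕ → ι → ℤ,
    (∀ x, ∑ p ∈ Finset.range k, e p x = 0) ∧
    (∀ y, ∑ p ∈ Finset.range k, e p ((σ p).symm y) = 0) ∧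
    (∀ p < k, ∀ x, (e p x).natAbs ∈ S) ∧
    ∀ a ∈ S, ∃ p < k, ∃ x, (e p x).natAbs = a

namespace Realizes

variable {ι : Type} {k l : ℕ} {σ τ : ℕ → Equiv.Perm ι} {S T : Set ℕ}

theorem zero : Realizes 0 σ (∅ : Set ℕ) := ⟨0, by simp, by simp, by simp, by simp⟩

/-- The two groups are balanced separately. Disjointness of the diagonals plays no role yet; it is
required only when the array is assembled. -/
theorem append (h₁ : Realizes k σ S) (h₂ : Realizes l (fun p => σ (k + p)) T) :
    Realizes (k + l) σ (S ∪ T) := by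
  obtain ⟨e, hr, hc, hm, hs⟩ := h₁
  obtain ⟨f, hr', hc', hm', hs'⟩ := h₂
  have low : ∀ p ∈ Finset.range k, p < k := fun p hp => Finset.mem_range.1 hp
  refine ⟨fun p x => if p < k then e p x else f (p - k) x, fun x => ?_, fun y => ?_, ?_, ?_⟩
  · rw [Finset.sum_range_add, Finset.sum_congr rfl fun p hp => if_pos (low p hp), hr]
    simpa using hr' x
  · rw [Finset.sum_range_add, Finset.sum_congr rfl fun p hp => if_pos (low p hp), hc]
    simpa using hc' y
  · intro p hp x
    by_cases h : p < k
    · simp only [h, if_true]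
      exact Or.inl (hm p h x)
    · simp only [h, if_false]
      exact Or.inr (hm' _ (by omega) x)
  · rintro a (ha | ha)
    · obtain ⟨p, hp, x, hx⟩ := hs a ha
      exact ⟨p, by omega, x, by simpa [hp] using hx⟩
    · obtain ⟨p, hp, x, hx⟩ := hs' a ha
      exact ⟨k + p, by omega, x, by simpa using hx⟩

theorem trans_right (h : Realizes k σ S) (π : Equiv.Perm ι) :
    Realizes k (fun p => (σ p).trans π) S := by
  obtain ⟨e, hr, hc, hm, hs⟩ := h
  exact ⟨e, hr, fun y => hc (π.symm y), hm, hs⟩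

theorem congr (h : Realizes k σ S) (hσ : ∀ p < k, σ p = τ p) : Realizes k τ S := by
  obtain ⟨e, hr, hc, hm, hs⟩ := h
  refine ⟨e, hr, fun y => ?_, hm, hs⟩
  rw [← hc y]
  exact Finset.sum_congr rfl fun p hp => by rw [hσ p (Finset.mem_range.1 hp)]

end Realizes

/-! ### From fillings of diagonals to Heffter arrays. -/

theorem card_and_sum_of_enumeration {n k : ℕ} (f : Fin n → Option ℤ) (c : ℕ → Fin n) (w : ℕ → ℤ)
    (hc : Set.InjOn c (Finset.range k)) (hf : ∀ p < k, f (c p) = some (w p))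
    (hs : ∀ j, (f j).isSome → ∃ p < k, c p = j) :
    (Finset.univ.filter fun j => (f j).isSome).card = k ∧
      ∑ j, (f j).getD 0 = ∑ p ∈ Finset.range k, w p := by
  constructor
  · have : (Finset.univ.filter fun j => (f j).isSome) = (Finset.range k).image c := by
      ext j
      simp only [Finset.mem_filter, Finset.mem_univ, true_and, Finset.mem_image,
        Finset.mem_range]
      constructor
      · exact hs j
      · rintro ⟨p, hp, rfl⟩
        rw [hf p hp]
        rfl
    rw [this, Finset.card_image_of_injOn hc, Finset.card_range]
  · refine (Finset.sum_of_injOn c hc (fun _ _ => by simp) ?_ ?_).symm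
    · intro j _ hj
      cases hfj : f j with
      | none => rfl
      | some b =>
        obtain ⟨p, hp, rfl⟩ := hs j (by rw [hfj]; rfl)
        exact absurd ⟨p, by simpa using hp, rfl⟩ hj
    · intro p hp
      rw [hf p (Finset.mem_range.1 hp)]
      rfl

namespace PFArray

variable {m n : ℕ} (A : PFArray m n ℤ) (v : ℕ)

theorem rowCount_toZMod (i : Fin m) : (A.toZMod v).rowCount i = A.rowCount i := by
  simp [rowCount, toZMod]

theorem colCount_toZMod (j : Fin n) : (A.toZMod v).colCount j = A.colCount j := by
  simp [colCount, toZMod]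

theorem cast_getD (o : Option ℤ) :
    (o.map fun a : ℤ => (a : ZMod v)).getD 0 = ((o.getD 0 : ℤ) : ZMod v) := by
  cases o <;> simp

theorem rowSum_toZMod (i : Fin m) : (A.toZMod v).rowSum i = ((A.rowSum i : ℤ) : ZMod v) := by
  simp only [rowSum, toZMod, Int.cast_sum, cast_getD]

theorem colSum_toZMod (j : Fin n) : (A.toZMod v).colSum j = ((A.colSum j : ℤ) : ZMod v) := by
  simp only [colSum, toZMod, Int.cast_sum, cast_getD]

theorem appears_toZMod {x : ZMod v} :
    (A.toZMod v).Appears x ↔ ∃ a : ℤ, A.Appears a ∧ (a : ZMod v) = x := by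
  constructor
  · rintro ⟨i, j, h⟩
    obtain ⟨a, ha, hx⟩ := Option.map_eq_some_iff.1 h
    exact ⟨a, ⟨i, j, ha⟩, hx⟩
  · rintro ⟨a, ⟨i, j, ha⟩, hx⟩
    exact ⟨i, j, Option.map_eq_some_iff.2 ⟨a, ha, hx⟩⟩

end PFArray

theorem cast_mem_subgroupOfOrder_iff {n k : ℕ} (hk : 1 ≤ k) (a : ℕ) :
    (a : ZMod (2 * n * k + k)) ∈ subgroupOfOrder (2 * n * k + k) k ↔ (2 * n + 1) ∣ a := by
  have hv : 2 * n * k + k = k * (2 * n + 1) := by ring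
  rw [subgroupOfOrder, show (2 * n * k + k) / k = 2 * n + 1 by
    rw [hv]; exact Nat.mul_div_cancel_left _ (by omega)]
  rw [AddSubgroup.mem_zmultiples_iff]
  constructor
  · rintro ⟨z, hz⟩
    rw [zsmul_eq_mul] at hz
    have h1 : ((z * (2 * n + 1 : ℕ) - a : ℤ) : ZMod (2 * n * k + k)) = 0 := by
      push_cast at hz ⊢
      rw [hz, sub_self]
    rw [ZMod.intCast_zmod_eq_zero_iff_dvd] at h1
    have h2 : ((2 * n + 1 : ℕ) : ℤ) ∣ ((2 * n * k + k : ℕ) : ℤ) := by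
      rw [hv]; exact_mod_cast dvd_mul_left _ _
    have h3 := (dvd_sub_right (dvd_mul_left ((2 * n + 1 : ℕ) : ℤ) z)).1 (h2.trans h1)
    exact_mod_cast h3
  · rintro ⟨c, rfl⟩
    exact ⟨c, by push_cast; rw [zsmul_eq_mul]; push_cast; ring⟩

/-- The hypothesis `hσ` says that the diagonals are disjoint, so the cell of row x and column σ p x
determines p and can hold e p x. -/
theorem existsIntegerHeffter_of_realizes {ι : Type} [Fintype ι] {n k : ℕ} (hk : 1 ≤ k)
    (hn : Fintype.card ι = n) {σ : ℕ → Equiv.Perm ι}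
    (h : Realizes k σ (halves n (Set.Iio k)))
    (hσ : ∀ x, ∀ p < k, ∀ q < k, σ p x = σ q x → p = q) : ExistsIntegerHeffter k n k := by
  classical
  obtain ⟨e, hr, hc, hm, hs⟩ := h
  let φ : ι ≃ Fin n := Fintype.equivFinOfCardEq hn
  let A : PFArray n n ℤ := fun i j =>
    if h : ∃ p < k, σ p (φ.symm i) = φ.symm j then some (e h.choose (φ.symm i)) else none
  have hA : ∀ x, ∀ p < k, A (φ x) (φ (σ p x)) = some (e p x) := by
    intro x p hp
    have hex : ∃ q < k, σ q (φ.symm (φ x)) = φ.symm (φ (σ p x)) := ⟨p, hp, by simp⟩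
    have h1 : A (φ x) (φ (σ p x)) = some (e hex.choose (φ.symm (φ x))) := dif_pos hex
    have h2 := hex.choose_spec
    generalize hex.choose = q at h1 h2
    rw [Equiv.symm_apply_apply, Equiv.symm_apply_apply] at h2
    rw [h1, hσ x _ h2.1 p hp h2.2, Equiv.symm_apply_apply]
  have hA' : ∀ i j, (A i j).isSome → ∃ p < k, σ p (φ.symm i) = φ.symm j := by
    intro i j hij
    by_contra hex
    have : A i j = none := dif_neg hex
    simp [this] at hij
  have row : ∀ i, A.rowCount i = k ∧ A.rowSum i = 0 := by
    intro i
    have := card_and_sum_of_enumeration (k := k) (A i) (fun p => φ (σ p (φ.symm i)))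
      (fun p => e p (φ.symm i)) ?_ ?_ ?_
    · exact ⟨this.1, this.2.trans (hr _)⟩
    · intro p hp q hq hpq
      exact hσ _ p (by simpa using hp) q (by simpa using hq) (φ.injective hpq)
    · intro p hp
      simpa using hA (φ.symm i) p hp
    · intro j hj
      obtain ⟨p, hp, hpj⟩ := hA' i j hj
      exact ⟨p, hp, by simp [hpj]⟩
  have col : ∀ j, A.colCount j = k ∧ A.colSum j = 0 := by
    intro j
    have := card_and_sum_of_enumeration (k := k) (fun i => A i j)
      (fun p => φ ((σ p).symm (φ.symm j))) (fun p => e p ((σ p).symm (φ.symm j))) ?_ ?_ ?_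
    · exact ⟨this.1, this.2.trans (hc _)⟩
    · intro p hp q hq hpq
      have h1 := φ.injective hpq
      refine hσ ((σ p).symm (φ.symm j)) p (by simpa using hp) q (by simpa using hq) ?_
      rw [Equiv.apply_symm_apply, h1, Equiv.apply_symm_apply]
    · intro p hp
      simpa using hA ((σ p).symm (φ.symm j)) p hp
    · intro i hi
      obtain ⟨p, hp, hpi⟩ := hA' i j hi
      exact ⟨p, hp, by simp [← hpi]⟩
  have app : ∀ a, A.Appears a → a.natAbs ∈ halves n (Set.Iio k) := by
    rintro a ⟨i, j, hij⟩
    obtain ⟨p, hp, hpj⟩ := hA' i j (by rw [hij]; rfl)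
    have := hA (φ.symm i) p hp
    rw [hpj, Equiv.apply_symm_apply, Equiv.apply_symm_apply, hij] at this
    rw [Option.some.inj this]
    exact hm p hp _
  refine ⟨A, ⟨⟨by omega, Dvd.intro_left _ rfl, fun i => ?_, fun j => ?_, fun x hx => ?_,
    fun i => ?_, fun j => ?_⟩, fun a ha => ?_, fun i => (row i).2, fun j => (col j).2⟩⟩
  · rw [PFArray.rowCount_toZMod, (row i).1]
  · rw [PFArray.colCount_toZMod, (col j).1]
  · have : NeZero (2 * n * k + k) := ⟨by omega⟩
    have key : ∀ a : ℕ, a ≤ (2 * n * k + k) / 2 → ∀ y : ZMod (2 * n * k + k), (a : ZMod _) = y →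
        y ∉ subgroupOfOrder (2 * n * k + k) k →
        (A.toZMod (2 * n * k + k)).Appears y ∨ (A.toZMod (2 * n * k + k)).Appears (-y) := by
      rintro a ha y rfl hy
      rw [cast_mem_subgroupOfOrder_iff hk] at hy
      obtain ⟨p, hp, x, hx⟩ := hs a (mem_halves ha hy)
      have h1 : A.Appears (e p x) := ⟨_, _, hA x p hp⟩
      rw [PFArray.appears_toZMod, PFArray.appears_toZMod]
      rcases Int.natAbs_eq (e p x) with h2 | h2
      · exact Or.inl ⟨_, h1, by rw [h2, hx]; simp⟩
      · exact Or.inr ⟨_, h1, by rw [h2, hx]; simp⟩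
    -- Residues beyond v/2 are treated through their negatives, which have representatives at most
    -- v/2.
    have hval := ZMod.val_lt x
    rcases le_or_gt x.val ((2 * n * k + k) / 2) with hle | hgt
    · exact key x.val hle x (by simp) hx
    · have := key (2 * n * k + k - x.val) (by omega) (-x)
        (by rw [Nat.cast_sub hval.le]; simp) (by rwa [neg_mem_iff])
      rw [neg_neg] at this
      exact this.symm
  · rw [PFArray.rowSum_toZMod, (row i).2, Int.cast_zero]
  · rw [PFArray.colSum_toZMod, (col j).2, Int.cast_zero]
  · have h1 := pos_of_mem_halves (app a ha)
    have h2 := le_of_mem_halves (app a ha)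
    rw [Int.abs_eq_natAbs]
    exact ⟨by exact_mod_cast h1, by exact_mod_cast h2⟩

/-! ### Explicit descriptions of short runs of half blocks. -/

theorem halfStart_add_two (n j : ℕ) : halfStart n (j + 2) = halfStart n j + (2 * n + 1) := by
  have e1 : (j + 2) / 2 = j / 2 + 1 := by omega
  have e2 : (j + 2) % 2 = j % 2 := by omega
  rw [halfStart, halfStart, e1, e2]
  ring

theorem mem_halves_Ico_four {n k a : ℕ} : a ∈ halves n (Set.Ico k (k + 4)) ↔
    ∃ v < n, a = halfStart n k + v ∨ a = halfStart n (k + 1) + v ∨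
      a = halfStart n k + (2 * n + 1) + v ∨ a = halfStart n (k + 1) + (2 * n + 1) + v := by
  constructor
  · rintro ⟨j, ⟨h1, h2⟩, v, hv, rfl⟩
    obtain rfl | rfl | rfl | rfl : j = k ∨ j = k + 1 ∨ j = k + 2 ∨ j = k + 1 + 2 := by omega
    all_goals
      refine ⟨v, hv, ?_⟩
      simp only [halfStart_add_two, true_or, or_true]
  · rintro ⟨v, hv, h | h | h | h⟩
    · exact ⟨k, ⟨by omega, by omega⟩, v, hv, h⟩
    · exact ⟨k + 1, ⟨by omega, by omega⟩, v, hv, h⟩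
    · exact ⟨k + 2, ⟨by omega, by omega⟩, v, hv, by rw [h, halfStart_add_two]⟩
    · exact ⟨k + 1 + 2, ⟨by omega, by omega⟩, v, hv, by rw [h, halfStart_add_two]⟩

theorem mem_halves_Iio_three {n a : ℕ} : a ∈ halves n (Set.Iio 3) ↔
    ∃ w, 1 ≤ w ∧ w ≤ n ∧ (a = w ∨ a = 2 * n + 1 - w ∨ a = 2 * n + 1 + w) := by
  constructor
  · rintro ⟨j, h, v, hv, rfl⟩
    rw [Set.mem_Iio] at h
    interval_cases j <;> norm_num [halfStart]
    · exact ⟨1 + v, by omega⟩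
    · exact ⟨n - v, by omega⟩
    · exact ⟨1 + v, by omega⟩
  · rintro ⟨w, h1, h2, h | h | h⟩
    · exact ⟨0, by simp, w - 1, by omega, by norm_num [halfStart]; omega⟩
    · exact ⟨1, by simp, n - w, by omega, by norm_num [halfStart]; omega⟩
    · exact ⟨2, by simp, w - 1, by omega, by norm_num [halfStart]; omega⟩

theorem mem_halves_Iio_five {n a : ℕ} : a ∈ halves n (Set.Iio 5) ↔
    ∃ w, 1 ≤ w ∧ w ≤ n ∧ (a = w ∨ a = 2 * n + 1 - w ∨ a = 2 * n + 1 + w ∨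
      a = 2 * (2 * n + 1) - w ∨ a = 2 * (2 * n + 1) + w) := by
  constructor
  · rintro ⟨j, h, v, hv, rfl⟩
    rw [Set.mem_Iio] at h
    interval_cases j <;> norm_num [halfStart]
    · exact ⟨1 + v, by omega⟩
    · exact ⟨n - v, by omega⟩
    · exact ⟨1 + v, by omega⟩
    · exact ⟨n - v, by omega⟩
    · exact ⟨1 + v, by omega⟩
  · rintro ⟨w, h1, h2, h | h | h | h | h⟩
    · exact ⟨0, by simp, w - 1, by omega, by norm_num [halfStart]; omega⟩
    · exact ⟨1, by simp, n - w, by omega, by norm_num [halfStart]; omega⟩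
    · exact ⟨2, by simp, w - 1, by omega, by norm_num [halfStart]; omega⟩
    · exact ⟨3, by simp, n - w, by omega, by norm_num [halfStart]; omega⟩
    · exact ⟨4, by simp, w - 1, by omega, by norm_num [halfStart]; omega⟩

/-! ### Cyclic diagonals, four at a time. -/

/-- Translation by `p` on the cyclic group of order `n`. -/
def cyclicPerm (n p : ℕ) : Equiv.Perm (ZMod n) := Equiv.addRight (p : ZMod n)

theorem cyclicPerm_symm_apply (n p : ℕ) (y : ZMod n) : (cyclicPerm n p).symm y = y - p := by
  simp [cyclicPerm, sub_eq_add_neg]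

theorem cyclicPerm_add (n k p : ℕ) :
    cyclicPerm n (k + p) = (cyclicPerm n p).trans (cyclicPerm n k) := by
  ext x
  simp only [cyclicPerm, Equiv.trans_apply, Equiv.coe_addRight]
  push_cast
  ring

/-- Half blocks k and k+2, and likewise k+1 and k+3, differ by 2n+1. In a row, the offsets cancel
within diagonals 0, 1 and within 2, 3. The shift by 2 makes the offsets cancel in a column between
diagonals 0, 2 and between 1, 3. -/
theorem realizes_cyclicPerm_four (n k : ℕ) [NeZero n] :
    Realizes 4 (cyclicPerm n) (halves n (Set.Ico k (k + 4))) := by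
  refine ⟨fun p x => match p with
    | 0 => halfStart n k + x.val
    | 1 => -(halfStart n (k + 1) + x.val)
    | 2 => -(halfStart n k + (2 * n + 1) + (x + 2).val)
    | _ => halfStart n (k + 1) + (2 * n + 1) + (x + 2).val, fun x => ?_, fun y => ?_, ?_, ?_⟩
  · simp only [Finset.sum_range_succ, Finset.sum_range_zero]
    ring
  · simp only [Finset.sum_range_succ, Finset.sum_range_zero, cyclicPerm_symm_apply]
    rw [show y - ((0 : ℕ) : ZMod n) = y by simp, show y - ((2 : ℕ) : ZMod n) + 2 = y by simp,
      show y - ((3 : ℕ) : ZMod n) + 2 = y - ((1 : ℕ) : ZMod n) by push_cast; ring]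
    ring
  · intro p hp x
    rw [mem_halves_Ico_four]
    have h1 := ZMod.val_lt x
    have h2 := ZMod.val_lt (x + 2)
    obtain rfl | rfl | rfl | rfl : p = 0 ∨ p = 1 ∨ p = 2 ∨ p = 3 := by omega
    all_goals simp only
    · exact ⟨_, h1, by omega⟩
    · exact ⟨_, h1, by omega⟩
    · exact ⟨_, h2, by omega⟩
    · exact ⟨_, h2, by omega⟩
  · intro a ha
    obtain ⟨v, hv, h⟩ := mem_halves_Ico_four.1 ha
    have h1 : ((v : ZMod n)).val = v := ZMod.val_cast_of_lt hv
    have h2 : ((v : ZMod n) - 2 + 2).val = v := by rw [sub_add_cancel, h1]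
    rcases h with h | h | h | h
    · exact ⟨0, by omega, v, by simp only [h1]; omega⟩
    · exact ⟨1, by omega, v, by simp only [h1]; omega⟩
    · exact ⟨2, by omega, v - 2, by simp only [h2]; omega⟩
    · exact ⟨3, by omega, v - 2, by simp only [h2]; omega⟩

theorem Realizes.cyclicPerm_add_four {n k : ℕ} [NeZero n]
    (h : Realizes k (cyclicPerm n) (halves n (Set.Iio k))) :
    Realizes (k + 4) (cyclicPerm n) (halves n (Set.Iio (k + 4))) := by
  have h4 := ((realizes_cyclicPerm_four n k).trans_right (cyclicPerm n k)).congr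
    (τ := fun p => cyclicPerm n (k + p)) fun p _ => (cyclicPerm_add n k p).symm
  rw [← Set.Iio_union_Ico_eq_Iio (show k ≤ k + 4 by omega), halves_union]
  exact h.append h4

theorem Realizes.cyclicPerm_add_four_mul {n k : ℕ} [NeZero n]
    (h : Realizes k (cyclicPerm n) (halves n (Set.Iio k))) (j : ℕ) :
    Realizes (k + 4 * j) (cyclicPerm n) (halves n (Set.Iio (k + 4 * j))) := by
  induction j with
  | zero => simpa using h
  | succ j ih => exact ih.cyclicPerm_add_four

theorem existsIntegerHeffter_of_cyclicPerm {n k : ℕ} (hk : 1 ≤ k) (hkn : k ≤ n)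
    (h : Realizes k (cyclicPerm n) (halves n (Set.Iio k))) : ExistsIntegerHeffter k n k := by
  have : NeZero n := ⟨by omega⟩
  refine existsIntegerHeffter_of_realizes hk (ZMod.card n) h fun x p hp q hq hpq => ?_
  simp only [cyclicPerm, Equiv.coe_addRight, add_right_inj] at hpq
  rw [ZMod.natCast_eq_natCast_iff', Nat.mod_eq_of_lt (by omega), Nat.mod_eq_of_lt (by omega)] at hpq
  exact hpq

/-! ### Three or five diagonals from labellings of a permutation. -/

/-- A labelling of the cycles of `c` whose labels, and whose sums of consecutive labels, are up to
sign exactly `1, …, n`. -/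
structure IsSumLabelling {ι : Type} (n : ℕ) (c : Equiv.Perm ι) (t : ι → ℤ) : Prop where
  label_mem : ∀ x, 1 ≤ (t x).natAbs ∧ (t x).natAbs ≤ n
  label_surj : ∀ w, 1 ≤ w → w ≤ n → ∃ x, (t x).natAbs = w
  sum_mem : ∀ x, 1 ≤ (t x + t (c.symm x)).natAbs ∧ (t x + t (c.symm x)).natAbs ≤ n
  sum_surj : ∀ w, 1 ≤ w → w ≤ n → ∃ x, (t x + t (c.symm x)).natAbs = w

/-- The middle diagonal takes the values 1, …, n. The outer ones contain 2n+1 + t and 2n+1 - t up to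
sign for each label t, hence both 2n+1 - w and 2n+1 + w whatever the sign of the label ±w. -/
theorem IsSumLabelling.realizes {ι : Type} {n : ℕ} {c : Equiv.Perm ι} {t : ι → ℤ}
    (h : IsSumLabelling n c t) {σ : ℕ → Equiv.Perm ι} (h0 : ∀ x, σ 0 x = x)
    (hs : ∀ p x, σ (p + 1) x = c (σ p x)) : Realizes 3 σ (halves n (Set.Iio 3)) := by
  have e0 : σ 0 = Equiv.refl ι := Equiv.ext h0
  have e1 : ∀ p, σ (p + 1) = (σ p).trans c := fun p => Equiv.ext (hs p)
  refine ⟨fun p x => match p with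
    | 0 => -(2 * n + 1 + t (c.symm x))
    | 1 => t x + t (c.symm x)
    | _ => 2 * n + 1 - t x, fun x => ?_, fun y => ?_, ?_, ?_⟩
  · simp only [Finset.sum_range_succ, Finset.sum_range_zero]
    ring
  · simp only [Finset.sum_range_succ, Finset.sum_range_zero, e0, e1, Equiv.symm_trans_apply,
      Equiv.refl_symm, Equiv.refl_apply]
    ring
  · intro p hp x
    rw [mem_halves_Iio_three]
    obtain rfl | rfl | rfl : p = 0 ∨ p = 1 ∨ p = 2 := by omega
    all_goals simp only
    · have := h.label_mem (c.symm x)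
      exact ⟨_, this.1, this.2, by omega⟩
    · exact ⟨_, (h.sum_mem x).1, (h.sum_mem x).2, Or.inl rfl⟩
    · have := h.label_mem x
      exact ⟨_, this.1, this.2, by omega⟩
  · intro a ha
    obtain ⟨w, h1, h2, h3⟩ := mem_halves_Iio_three.1 ha
    obtain ⟨x, hx⟩ := h.label_surj w h1 h2
    rcases h3 with rfl | h3
    · obtain ⟨y, hy⟩ := h.sum_surj a h1 h2
      exact ⟨1, by omega, y, hy⟩
    · by_cases hc : (2 * n + 1 - t x).natAbs = a
      · exact ⟨2, by omega, x, hc⟩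
      · refine ⟨0, by omega, c x, ?_⟩
        simp only [Equiv.symm_apply_apply]
        omega

/-- A pair of labellings by `1, …, n` up to sign for which the sums of two neighbouring labels of
`t` and two labels of `r` at distance two are again `1, …, n` up to sign. -/
structure IsSumLabellingPair {ι : Type} (n : ℕ) (c : Equiv.Perm ι) (t r : ι → ℤ) : Prop where
  left_mem : ∀ x, 1 ≤ (t x).natAbs ∧ (t x).natAbs ≤ n
  left_surj : ∀ w, 1 ≤ w → w ≤ n → ∃ x, (t x).natAbs = w
  right_mem : ∀ x, 1 ≤ (r x).natAbs ∧ (r x).natAbs ≤ n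
  right_surj : ∀ w, 1 ≤ w → w ≤ n → ∃ x, (r x).natAbs = w
  sum_mem : ∀ x, 1 ≤ (t x + t (c.symm x) + r x + r (c.symm (c.symm x))).natAbs ∧
    (t x + t (c.symm x) + r x + r (c.symm (c.symm x))).natAbs ≤ n
  sum_surj : ∀ w, 1 ≤ w → w ≤ n →
    ∃ x, (t x + t (c.symm x) + r x + r (c.symm (c.symm x))).natAbs = w

/-- As with three diagonals, with a further outer pair 2(2n+1) ± r. Its two diagonals are four steps
apart, two on each side of the middle one, whence the labels of r at distance two. -/
theorem IsSumLabellingPair.realizes {ι : Type} {n : ℕ} {c : Equiv.Perm ι} {t r : ι → ℤ}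
    (h : IsSumLabellingPair n c t r) {σ : ℕ → Equiv.Perm ι} (h0 : ∀ x, σ 0 x = x)
    (hs : ∀ p x, σ (p + 1) x = c (σ p x)) : Realizes 5 σ (halves n (Set.Iio 5)) := by
  have e0 : σ 0 = Equiv.refl ι := Equiv.ext h0
  have e1 : ∀ p, σ (p + 1) = (σ p).trans c := fun p => Equiv.ext (hs p)
  refine ⟨fun p x => match p with
    | 0 => -(2 * (2 * n + 1) + r (c.symm (c.symm x)))
    | 1 => -(2 * n + 1 + t (c.symm x))
    | 2 => t x + t (c.symm x) + r x + r (c.symm (c.symm x))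
    | 3 => 2 * n + 1 - t x
    | _ => 2 * (2 * n + 1) - r x, fun x => ?_, fun y => ?_, ?_, ?_⟩
  · simp only [Finset.sum_range_succ, Finset.sum_range_zero]
    ring
  · simp only [Finset.sum_range_succ, Finset.sum_range_zero, e0, e1, Equiv.symm_trans_apply,
      Equiv.refl_symm, Equiv.refl_apply]
    ring
  · intro p hp x
    rw [mem_halves_Iio_five]
    obtain rfl | rfl | rfl | rfl | rfl : p = 0 ∨ p = 1 ∨ p = 2 ∨ p = 3 ∨ p = 4 := by omega
    all_goals simp only
    · have := h.right_mem (c.symm (c.symm x))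
      exact ⟨_, this.1, this.2, by omega⟩
    · have := h.left_mem (c.symm x)
      exact ⟨_, this.1, this.2, by omega⟩
    · exact ⟨_, (h.sum_mem x).1, (h.sum_mem x).2, Or.inl rfl⟩
    · have := h.left_mem x
      exact ⟨_, this.1, this.2, by omega⟩
    · have := h.right_mem x
      exact ⟨_, this.1, this.2, by omega⟩
  · intro a ha
    obtain ⟨w, h1, h2, h3⟩ := mem_halves_Iio_five.1 ha
    obtain ⟨x, hx⟩ := h.left_surj w h1 h2
    obtain ⟨x', hx'⟩ := h.right_surj w h1 h2
    rcases h3 with rfl | h3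
    · obtain ⟨y, hy⟩ := h.sum_surj a h1 h2
      exact ⟨2, by omega, y, hy⟩
    · by_cases hc : (2 * n + 1 - t x).natAbs = a
      · exact ⟨3, by omega, x, hc⟩
      by_cases hc' : (2 * (2 * n + 1) - r x').natAbs = a
      · exact ⟨4, by omega, x', hc'⟩
      by_cases hc'' : (-(2 * n + 1 + t x)).natAbs = a
      · exact ⟨1, by omega, c x, by simpa using hc''⟩
      · refine ⟨0, by omega, c (c x'), ?_⟩
        simp only [Equiv.symm_apply_apply]
        omega

/-! ### Diagonals made of 2 × 2 blocks. -/

/-- Translations of `ZMod m × ZMod 2`; the permutations of index `2 q` and `2 q + 1` together cover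
the `2 × 2` blocks on the `i`-th pair of rows and the `(i + q)`-th pair of columns. -/
def blockPerm (m p : ℕ) : Equiv.Perm (ZMod m × ZMod 2) :=
  Equiv.addRight (((p / 2 : ℕ) : ZMod m), ((p : ℕ) : ZMod 2))

theorem blockPerm_symm_apply (m p : ℕ) (y : ZMod m × ZMod 2) :
    (blockPerm m p).symm y = (y.1 - (p / 2 : ℕ), y.2 - p) := by
  simp [blockPerm, sub_eq_add_neg, Prod.ext_iff]

theorem blockPerm_two_mul_add (m a p : ℕ) :
    blockPerm m (2 * a + p) = (blockPerm m p).trans (blockPerm m (2 * a)) := by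
  ext x
  · simp only [blockPerm, Equiv.trans_apply, Equiv.coe_addRight, Prod.fst_add]
    rw [show (2 * a + p) / 2 = a + p / 2 by omega, show 2 * a / 2 = a by omega]
    push_cast
    ring
  · simp only [blockPerm, Equiv.trans_apply, Equiv.coe_addRight, Prod.snd_add]
    push_cast
    ring

theorem sum_range_two_mul_eq (f : ℕ → ℤ) (K : ℕ) :
    ∑ p ∈ Finset.range (2 * K), f p = ∑ q ∈ Finset.range K, (f (2 * q) + f (2 * q + 1)) := by
  induction K with
  | zero => simp
  | succ K ih => rw [Finset.sum_range_succ, ← ih, mul_add, mul_one, Finset.sum_range_succ,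
      Finset.sum_range_succ, add_assoc]

/-- Block q in row pair i is [[A, B], [κ - A, -κ - B]]. Its column sums are κ and -κ and its row
sums are ±(A + B). As κ does not depend on i, the columns balance once the κ q add up to 0. -/
theorem realizes_blockPerm {m K : ℕ} [NeZero m] {S : Set ℕ} (A B : ℕ → ℕ → ℤ) (κ : ℕ → ℤ)
    (hκ : ∑ q ∈ Finset.range K, κ q = 0)
    (hAB : ∀ i < m, ∑ q ∈ Finset.range K, (A q i + B q i) = 0)
    (hS : ∀ q < K, ∀ i < m, (A q i).natAbs ∈ S ∧ (B q i).natAbs ∈ S ∧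
      (κ q - A q i).natAbs ∈ S ∧ (κ q + B q i).natAbs ∈ S)
    (hc : ∀ a ∈ S, ∃ q < K, ∃ i < m, (A q i).natAbs = a ∨ (B q i).natAbs = a ∨
      (κ q - A q i).natAbs = a ∨ (κ q + B q i).natAbs = a) :
    Realizes (2 * K) (blockPerm m) S := by
  have ev : ∀ q, 2 * q / 2 = q ∧ 2 * q % 2 = 0 := by omega
  have od : ∀ q, (2 * q + 1) / 2 = q ∧ (2 * q + 1) % 2 ≠ 0 := by omega
  have two : (2 : ZMod 2) = 0 := rfl
  have one : (1 : ZMod 2) ≠ 0 := by decide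
  have neg : (0 - 1 : ZMod 2) = 1 := by decide
  have cases : ∀ b : ZMod 2, b = 0 ∨ b = 1 := by decide
  refine ⟨fun p x => if x.2 = 0 then
      (if p % 2 = 0 then A (p / 2) x.1.val else B (p / 2) x.1.val) else
      (if p % 2 = 0 then -(κ (p / 2) + B (p / 2) x.1.val) else κ (p / 2) - A (p / 2) x.1.val),
    fun x => ?_, fun y => ?_, ?_, ?_⟩
  · obtain ⟨i, b⟩ := x
    rw [sum_range_two_mul_eq]
    have h := hAB i.val (ZMod.val_lt i)
    rcases cases b with rfl | rfl
    · simpa [ev, od] using h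
    · simp only [ev, od, one, if_true, if_false]
      rw [← neg_eq_zero, ← Finset.sum_neg_distrib, ← h]
      exact Finset.sum_congr rfl fun q _ => by ring
  · obtain ⟨j, b⟩ := y
    rw [sum_range_two_mul_eq]
    simp only [blockPerm_symm_apply, ev, od, Nat.cast_add, Nat.cast_mul, Nat.cast_ofNat, two,
      Nat.cast_one, zero_mul, zero_add, sub_zero]
    rcases cases b with rfl | rfl
    · simp only [neg, one, if_true, if_false, add_sub_cancel]
      exact hκ
    · simp only [sub_self, one, if_true, if_false]
      rw [← neg_eq_zero, ← Finset.sum_neg_distrib, ← hκ]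
      exact Finset.sum_congr rfl fun q _ => by ring
  · intro p hp x
    obtain ⟨h1, h2, h3, h4⟩ := hS (p / 2) (by omega) x.1.val (ZMod.val_lt _)
    dsimp only
    split_ifs
    · exact h1
    · exact h2
    · rwa [Int.natAbs_neg]
    · exact h3
  · intro a ha
    obtain ⟨q, hq, i, hi, h⟩ := hc a ha
    have hv : ((i : ZMod m)).val = i := ZMod.val_cast_of_lt hi
    rcases h with h | h | h | h
    · exact ⟨2 * q, by omega, (i, 0), by simpa [ev, hv] using h⟩
    · exact ⟨2 * q + 1, by omega, (i, 0), by simpa [od, hv] using h⟩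
    · exact ⟨2 * q + 1, by omega, (i, 1), by simpa [od, hv] using h⟩
    · refine ⟨2 * q, by omega, (i, 1), ?_⟩
      simp only [ev, hv, one, if_true, if_false, Int.natAbs_neg]
      exact h

/-- Taking κ = ±(2n+1) pairs half block k with k+2 and k+1 with k+3. The values A + B are -1 and 1.
-/
theorem realizes_blockPerm_four (m k : ℕ) [NeZero m] :
    Realizes 4 (blockPerm m) (halves (2 * m) (Set.Ico k (k + 4))) := by
  set b := halfStart (2 * m) k with hb
  set b' := halfStart (2 * m) (k + 1) with hb'
  refine realizes_blockPerm (K := 2)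
    (fun q i => match q with
      | 0 => b + 2 * i + (2 * (2 * m) + 1)
      | _ => -(b' + 2 * i + (2 * (2 * m) + 1)))
    (fun q i => match q with
      | 0 => -(b + 2 * i + 1 + (2 * (2 * m) + 1))
      | _ => b' + 2 * i + 1 + (2 * (2 * m) + 1))
    (fun q => match q with
      | 0 => 2 * (2 * m) + 1
      | _ => -(2 * (2 * m) + 1)) ?_ (fun i hi => ?_) ?_ ?_
  · simp [Finset.sum_range_succ]
  · simp only [Finset.sum_range_succ, Finset.sum_range_zero]
    ring
  · intro q hq i hi
    simp only [mem_halves_Ico_four, ← hb, ← hb']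
    obtain rfl | rfl : q = 0 ∨ q = 1 := by omega
    all_goals
      simp only
      exact ⟨⟨2 * i, by omega, by omega⟩, ⟨2 * i + 1, by omega, by omega⟩,
        ⟨2 * i, by omega, by omega⟩, ⟨2 * i + 1, by omega, by omega⟩⟩
  · intro a ha
    obtain ⟨v, hv, h⟩ := mem_halves_Ico_four.1 ha
    rw [← hb, ← hb'] at h
    rcases h with h | h | h | h
    · exact ⟨0, by omega, v / 2, by omega, by simp only; omega⟩
    · exact ⟨1, by omega, v / 2, by omega, by simp only; omega⟩
    · exact ⟨0, by omega, v / 2, by omega, by simp only; omega⟩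
    · exact ⟨1, by omega, v / 2, by omega, by simp only; omega⟩

/-- With n = 4h, the constants 4h+1, -4h and -1 add up to 0. The first two use pairs of intervals at
those distances; the third uses four consecutive integers Q, …, Q+3 per block, cut from the
intervals at c₁ and c₂. The row contributions are -1, -1 and 2. The set is left general so that it
can be half blocks 0–5 or 3–8. -/
theorem realizes_blockPerm_six_of_even {h a₁ a₂ c₁ c₂ : ℕ} [NeZero (2 * h)] {S : Set ℕ}
    (hS : ∀ a, a ∈ S ↔ ∃ v < 4 * h, a = a₁ + v ∨ a = a₁ + (4 * h + 1) + v ∨ a = a₂ + v ∨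
      a = a₂ + 4 * h + v ∨ a = c₁ + v ∨ a = c₂ + v) :
    Realizes 6 (blockPerm (2 * h)) S := by
  let Q : ℕ → ℕ := fun i => if i < h then c₁ + 4 * i else c₂ + 4 * (i - h)
  have hQ : ∀ i < 2 * h, ∃ u, u + 3 < 4 * h ∧ (Q i = c₁ + u ∨ Q i = c₂ + u) := by
    intro i hi
    by_cases hc : i < h
    · exact ⟨4 * i, by omega, Or.inl (if_pos hc)⟩
    · exact ⟨4 * (i - h), by omega, Or.inr (if_neg hc)⟩
  refine realizes_blockPerm (K := 3)
    (fun q i => match q with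
      | 0 => a₁ + 2 * i + (4 * h + 1)
      | 1 => a₂ + 2 * i
      | _ => -(Q i + 1))
    (fun q i => match q with
      | 0 => -(a₁ + 2 * i + 1 + (4 * h + 1))
      | 1 => -(a₂ + 2 * i + 1)
      | _ => Q i + 3)
    (fun q => match q with
      | 0 => 4 * h + 1
      | 1 => -(4 * h)
      | _ => -1) ?_ (fun i hi => ?_) ?_ ?_
  · simp [Finset.sum_range_succ]
  · simp only [Finset.sum_range_succ, Finset.sum_range_zero]
    ring
  · intro q hq i hi
    simp only [hS]
    obtain rfl | rfl | rfl : q = 0 ∨ q = 1 ∨ q = 2 := by omega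
    · simp only
      exact ⟨⟨2 * i, by omega, by omega⟩, ⟨2 * i + 1, by omega, by omega⟩,
        ⟨2 * i, by omega, by omega⟩, ⟨2 * i + 1, by omega, by omega⟩⟩
    · simp only
      exact ⟨⟨2 * i, by omega, by omega⟩, ⟨2 * i + 1, by omega, by omega⟩,
        ⟨2 * i, by omega, by omega⟩, ⟨2 * i + 1, by omega, by omega⟩⟩
    · obtain ⟨u, hu, hu'⟩ := hQ i hi
      simp only
      exact ⟨⟨u + 1, by omega, by omega⟩, ⟨u + 3, by omega, by omega⟩,
        ⟨u, by omega, by omega⟩, ⟨u + 2, by omega, by omega⟩⟩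
  · intro a ha
    obtain ⟨v, hv, hv'⟩ := (hS a).1 ha
    rcases hv' with hv' | hv' | hv' | hv' | hv' | hv'
    · exact ⟨0, by omega, v / 2, by omega, by simp only; omega⟩
    · exact ⟨0, by omega, v / 2, by omega, by simp only; omega⟩
    · exact ⟨1, by omega, v / 2, by omega, by simp only; omega⟩
    · exact ⟨1, by omega, v / 2, by omega, by simp only; omega⟩
    · have : Q (v / 4) = c₁ + 4 * (v / 4) := if_pos (by omega)
      exact ⟨2, by omega, v / 4, by omega, by simp only [this]; omega⟩
    · have : Q (h + v / 4) = c₂ + 4 * (h + v / 4 - h) := if_neg (by omega)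
      exact ⟨2, by omega, h + v / 4, by omega, by simp only [this]; omega⟩

theorem mem_halves_Iio_six {n a : ℕ} : a ∈ halves n (Set.Iio 6) ↔
    (1 ≤ a ∧ a ≤ 2 * n) ∨ (2 * n + 2 ≤ a ∧ a ≤ 4 * n + 1) ∨ (4 * n + 3 ≤ a ∧ a ≤ 6 * n + 2) := by
  constructor
  · rintro ⟨j, h, v, hv, rfl⟩
    rw [Set.mem_Iio] at h
    interval_cases j <;> norm_num [halfStart] <;> omega
  · intro h
    have : ∃ v < n, a = 1 + v ∨ a = n + 1 + v ∨ a = 2 * n + 2 + v ∨ a = 3 * n + 2 + v ∨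
        a = 4 * n + 3 + v ∨ a = 5 * n + 3 + v := by
      rcases h with h | h | h
      · by_cases h' : a ≤ n
        · exact ⟨a - 1, by omega, by omega⟩
        · exact ⟨a - n - 1, by omega, by omega⟩
      · by_cases h' : a ≤ 3 * n + 1
        · exact ⟨a - 2 * n - 2, by omega, by omega⟩
        · exact ⟨a - 3 * n - 2, by omega, by omega⟩
      · by_cases h' : a ≤ 5 * n + 2
        · exact ⟨a - 4 * n - 3, by omega, by omega⟩
        · exact ⟨a - 5 * n - 3, by omega, by omega⟩
    obtain ⟨v, hv, h | h | h | h | h | h⟩ := this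
    · exact ⟨0, by simp, v, hv, by norm_num [halfStart]; omega⟩
    · exact ⟨1, by simp, v, hv, by norm_num [halfStart]; omega⟩
    · exact ⟨2, by simp, v, hv, by norm_num [halfStart]; omega⟩
    · exact ⟨3, by simp, v, hv, by norm_num [halfStart]; omega⟩
    · exact ⟨4, by simp, v, hv, by norm_num [halfStart]; omega⟩
    · exact ⟨5, by simp, v, hv, by norm_num [halfStart]; omega⟩

/-- Now n = 4h+2 is not a multiple of 4, so cutting half blocks 0 and 3 into quadruples leaves {1,
2} and {12h+12, 12h+13}. These form the κ = -1 block of the exceptional row pair i = 0. There the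
other two blocks are rearranged within their pairs so that the row contributions 12h+10, 1 and
-(12h+11) cancel. -/
theorem realizes_blockPerm_six_of_odd {h : ℕ} (hh : 1 ≤ h) :
    Realizes 6 (blockPerm (2 * h + 1)) (halves (2 * (2 * h + 1)) (Set.Iio 6)) := by
  let Q : ℕ → ℕ := fun i => if i ≤ h then 4 * i - 1 else
    if i = h + 1 then 12 * h + 8 else 12 * h + 14 + 4 * (i - h - 2)
  have hQ : ∀ i, 1 ≤ i → i < 2 * h + 1 → (3 ≤ Q i ∧ Q i + 3 ≤ 4 * h + 2) ∨
      (12 * h + 8 ≤ Q i ∧ Q i + 3 ≤ 16 * h + 9) := by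
    intro i hi hi'
    simp only [Q]
    split_ifs <;> omega
  refine realizes_blockPerm (K := 3)
    (fun q i => match q with
      | 0 => 8 * h + 6 + 2 * i
      | 1 => if i = 0 then -(20 * h + 13) else 16 * h + 11 + 2 * i
      | _ => if i = 0 then -(12 * h + 13) else -(Q i + 1))
    (fun q i => match q with
      | 0 => if i = 0 then 4 * h + 4 else -(8 * h + 7 + 2 * i)
      | 1 => if i = 0 then 20 * h + 14 else -(16 * h + 12 + 2 * i)
      | _ => if i = 0 then 2 else Q i + 3)
    (fun q => match q with
      | 0 => 4 * h + 3
      | 1 => -(4 * h + 2)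
      | _ => -1) ?_ (fun i hi => ?_) ?_ ?_
  · simp only [Finset.sum_range_succ, Finset.sum_range_zero]
    ring
  · simp only [Finset.sum_range_succ, Finset.sum_range_zero]
    split_ifs with h0
    · subst h0
      push_cast
      ring
    · ring
  · intro q hq i hi
    simp only [mem_halves_Iio_six]
    obtain rfl | rfl | rfl : q = 0 ∨ q = 1 ∨ q = 2 := by omega
    · simp only
      split_ifs <;> omega
    · simp only
      split_ifs <;> omega
    · simp only
      split_ifs with h0
      · omega
      · have := hQ i (by omega) hi
        omega
  · intro a ha
    rw [mem_halves_Iio_six] at ha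
    have small : ∀ i, 1 ≤ i → i ≤ h → Q i = 4 * i - 1 := fun i _ h2 => if_pos h2
    have mid : Q (h + 1) = 12 * h + 8 := by simp [Q]
    have big : ∀ j, Q (h + 2 + j) = 12 * h + 14 + 4 * j := by
      intro j
      simp only [Q]
      rw [if_neg (by omega), if_neg (by omega)]
      omega
    by_cases h1 : a ≤ 4 * h + 2
    · by_cases h2 : a ≤ 2
      · exact ⟨2, by omega, 0, by omega, by simp only [if_true]; omega⟩
      · refine ⟨2, by omega, (a + 1) / 4, by omega, ?_⟩
        simp only [small _ (show 1 ≤ (a + 1) / 4 by omega) (show (a + 1) / 4 ≤ h by omega)]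
        rw [if_neg (by omega), if_neg (by omega)]
        omega
    by_cases h2 : a ≤ 8 * h + 4
    · refine ⟨0, by omega, (a - (4 * h + 3)) / 2, by omega, ?_⟩
      simp only
      split_ifs <;> omega
    by_cases h3 : a ≤ 12 * h + 7
    · refine ⟨0, by omega, (a - (8 * h + 6)) / 2, by omega, ?_⟩
      simp only
      split_ifs <;> omega
    by_cases h4 : a ≤ 12 * h + 11
    · refine ⟨2, by omega, h + 1, by omega, ?_⟩
      simp only [mid]
      rw [if_neg (by omega), if_neg (by omega)]
      omega
    by_cases h5 : a ≤ 12 * h + 13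
    · exact ⟨2, by omega, 0, by omega, by simp only [if_true]; omega⟩
    by_cases h6 : a ≤ 16 * h + 9
    · refine ⟨2, by omega, h + 2 + (a - (12 * h + 14)) / 4, by omega, ?_⟩
      simp only [big]
      rw [if_neg (by omega), if_neg (by omega)]
      omega
    by_cases h7 : a ≤ 20 * h + 12
    · refine ⟨1, by omega, (a - (16 * h + 11)) / 2, by omega, ?_⟩
      simp only
      split_ifs <;> omega
    · refine ⟨1, by omega, (a - (20 * h + 13)) / 2, by omega, ?_⟩
      simp only
      split_ifs <;> omega

theorem realizes_blockPerm_six {m : ℕ} (hm : 3 ≤ m) :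
    Realizes 6 (blockPerm m) (halves (2 * m) (Set.Iio 6)) := by
  obtain ⟨h, rfl | rfl⟩ := m.even_or_odd'
  · have : NeZero (2 * h) := ⟨by omega⟩
    refine realizes_blockPerm_six_of_even (a₁ := 4 * h + 1) (a₂ := 16 * h + 3) (c₁ := 1)
      (c₂ := 12 * h + 2) fun a => ?_
    rw [mem_halves_Iio_six]
    constructor
    · intro ha
      by_cases h1 : a ≤ 4 * h
      · exact ⟨a - 1, by omega, by omega⟩
      by_cases h2 : a ≤ 8 * h
      · exact ⟨a - (4 * h + 1), by omega, by omega⟩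
      by_cases h3 : a ≤ 12 * h + 1
      · exact ⟨a - (8 * h + 2), by omega, by omega⟩
      by_cases h4 : a ≤ 16 * h + 1
      · exact ⟨a - (12 * h + 2), by omega, by omega⟩
      by_cases h5 : a ≤ 20 * h + 2
      · exact ⟨a - (16 * h + 3), by omega, by omega⟩
      · exact ⟨a - (20 * h + 3), by omega, by omega⟩
    · rintro ⟨v, hv, h⟩
      omega
  · exact realizes_blockPerm_six_of_odd (by omega)

theorem realizes_blockPerm_six_from_three {h : ℕ} (hh : 1 ≤ h) :
    Realizes 6 (blockPerm (2 * h)) (halves (4 * h) (Set.Ico 3 9)) := by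
  have : NeZero (2 * h) := ⟨by omega⟩
  refine realizes_blockPerm_six_of_even (a₁ := 12 * h + 2) (a₂ := 24 * h + 4) (c₁ := 20 * h + 3)
    (c₂ := 32 * h + 5) fun a => ?_
  constructor
  · rintro ⟨j, ⟨h1, h2⟩, v, hv, rfl⟩
    refine ⟨v, hv, ?_⟩
    interval_cases j <;> norm_num [halfStart] <;> omega
  · rintro ⟨v, hv, h | h | h | h | h | h⟩
    · exact ⟨3, by simp, v, hv, by norm_num [halfStart]; omega⟩
    · exact ⟨4, by simp, v, hv, by norm_num [halfStart]; omega⟩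
    · exact ⟨6, by simp, v, hv, by norm_num [halfStart]; omega⟩
    · exact ⟨7, by simp, v, hv, by norm_num [halfStart]; omega⟩
    · exact ⟨5, by simp, v, hv, by norm_num [halfStart]; omega⟩
    · exact ⟨8, by simp, v, hv, by norm_num [halfStart]; omega⟩

/-! ### Explicit labellings of an n-cycle. -/

/-- The predecessor of `i` in the cyclic order of `0, …, n - 1`. -/
def cyclicPred (n i : ℕ) : ℕ := if i = 0 then n - 1 else i - 1

/-- `idx` numbers the points of a cycle of length `n` consecutively. -/
structure IsCycleIndex {ι : Type} (n : ℕ) (c : Equiv.Perm ι) (idx : ι → ℕ) : Prop where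
  lt : ∀ x, idx x < n
  surj : ∀ i < n, ∃ x, idx x = i
  symm : ∀ x, idx (c.symm x) = cyclicPred n (idx x)

theorem IsCycleIndex.of_apply {ι : Type} {n : ℕ} {c : Equiv.Perm ι} {idx : ι → ℕ}
    (hlt : ∀ x, idx x < n) (hsurj : ∀ i < n, ∃ x, idx x = i)
    (hc : ∀ x, idx (c x) = (idx x + 1) % n) : IsCycleIndex n c idx := by
  refine ⟨hlt, hsurj, fun x => ?_⟩
  have h1 := hc (c.symm x)
  have h2 := hlt (c.symm x)
  rw [Equiv.apply_symm_apply] at h1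
  rw [cyclicPred]
  rcases Nat.lt_or_ge (idx (c.symm x) + 1) n with h3 | h3
  · rw [Nat.mod_eq_of_lt h3] at h1
    split_ifs <;> omega
  · have h4 : idx (c.symm x) + 1 = n := by omega
    rw [h4, Nat.mod_self] at h1
    rw [if_pos h1]
    omega

theorem isCycleIndex_cyclicPerm (n : ℕ) [NeZero n] :
    IsCycleIndex n (cyclicPerm n 1) (fun x => x.val) := by
  refine .of_apply ZMod.val_lt (fun i hi => ⟨i, ZMod.val_cast_of_lt hi⟩) fun x => ?_
  rw [cyclicPerm, Equiv.coe_addRight, ZMod.val_add, ZMod.val_natCast, Nat.add_mod_mod]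

/-- The cycle that runs through the points `(i, 0), (i, 1)` for `i = 0, 1, …`. -/
def blockCycle (m : ℕ) : Equiv.Perm (ZMod m × ZMod 2) where
  toFun x := if x.2 = 0 then (x.1, 1) else (x.1 + 1, 0)
  invFun x := if x.2 = 0 then (x.1 - 1, 1) else (x.1, 0)
  left_inv := by
    rintro ⟨i, b⟩
    obtain rfl | rfl : b = 0 ∨ b = 1 := by revert b; decide
    all_goals simp
  right_inv := by
    rintro ⟨i, b⟩
    obtain rfl | rfl : b = 0 ∨ b = 1 := by revert b; decide
    all_goals simp

theorem blockCycle_apply (m : ℕ) (x : ZMod m × ZMod 2) :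
    blockCycle m x = if x.2 = 0 then (x.1, 1) else (x.1 + 1, 0) := rfl

theorem isCycleIndex_blockCycle (m : ℕ) [NeZero m] :
    IsCycleIndex (2 * m) (blockCycle m) (fun x => 2 * x.1.val + x.2.val) := by
  have v0 : (0 : ZMod 2).val = 0 := rfl
  have v1 : (1 : ZMod 2).val = 1 := rfl
  refine .of_apply (fun x => ?_) (fun i hi => ?_) fun x => ?_
  · have h1 := ZMod.val_lt x.1
    have h2 := ZMod.val_lt x.2
    omega
  · refine ⟨((i / 2 : ℕ), (i : ℕ)), ?_⟩
    simp only [ZMod.val_natCast]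
    rw [Nat.mod_eq_of_lt (show i / 2 < m by omega)]
    omega
  · obtain ⟨i, b⟩ := x
    have h1 := ZMod.val_lt i
    obtain rfl | rfl : b = 0 ∨ b = 1 := by revert b; decide
    · simp only [blockCycle_apply, if_true, v0, v1]
      rw [Nat.mod_eq_of_lt (by omega)]
    · simp only [blockCycle_apply, one_ne_zero, if_false, v0, v1]
      have h2 : (i + 1).val = (i.val + 1) % m := by
        rw [ZMod.val_add, ← Nat.cast_one, ZMod.val_natCast, Nat.add_mod_mod]
      rw [h2, show 2 * i.val + 1 + 1 = 2 * (i.val + 1) by ring, Nat.mul_mod_mul_left]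
      rfl

theorem IsCycleIndex.isSumLabelling {ι : Type} {n : ℕ} {c : Equiv.Perm ι} {idx : ι → ℕ}
    (hi : IsCycleIndex n c idx) {t : ℕ → ℤ}
    (h1 : ∀ i < n, 1 ≤ (t i).natAbs ∧ (t i).natAbs ≤ n)
    (h2 : ∀ w, 1 ≤ w → w ≤ n → ∃ i < n, (t i).natAbs = w)
    (h3 : ∀ i < n, 1 ≤ (t i + t (cyclicPred n i)).natAbs ∧ (t i + t (cyclicPred n i)).natAbs ≤ n)
    (h4 : ∀ w, 1 ≤ w → w ≤ n → ∃ i < n, (t i + t (cyclicPred n i)).natAbs = w) :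
    IsSumLabelling n c fun x => t (idx x) where
  label_mem x := h1 _ (hi.lt x)
  label_surj w hw hw' := by
    obtain ⟨i, hin, h⟩ := h2 w hw hw'
    obtain ⟨x, rfl⟩ := hi.surj i hin
    exact ⟨x, h⟩
  sum_mem x := by simpa only [hi.symm] using h3 _ (hi.lt x)
  sum_surj w hw hw' := by
    obtain ⟨i, hin, h⟩ := h4 w hw hw'
    obtain ⟨x, rfl⟩ := hi.surj i hin
    exact ⟨x, by simpa only [hi.symm] using h⟩

/-- The zigzag -n, 1, -(n-1), 2, … has sums n - i in absolute value. Reversing all signs from i =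
2q+2 on changes only the sum there, from 2q+1 to n; the closing edge then supplies the lost 2q+1. -/
theorem exists_isSumLabelling_of_mod_four_eq_three {ι : Type} {q : ℕ} {c : Equiv.Perm ι}
    {idx : ι → ℕ} (hi : IsCycleIndex (4 * q + 3) c idx) :
    ∃ t, IsSumLabelling (4 * q + 3) c t := by
  let t : ℕ → ℤ := fun i =>
    if i < 2 * q + 2 then (if i % 2 = 0 then -(4 * q + 3 - (i / 2 : ℕ)) else (i / 2 : ℕ) + 1)
    else (if i % 2 = 0 then 4 * q + 3 - (i / 2 : ℕ) else -((i / 2 : ℕ) + 1))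
  have sum_zero : (t 0 + t (4 * q + 2)).natAbs = 2 * q + 1 := by
    have e1 : t 0 = -(4 * q + 3) := by simp [t]
    have e2 : t (4 * q + 2) = 2 * q + 2 := by
      simp only [t]
      split_ifs <;> omega
    rw [e1, e2]
    omega
  have sum_eq : ∀ i, 1 ≤ i → i < 4 * q + 3 → (t i + t (i - 1)).natAbs =
      if i = 2 * q + 2 then 4 * q + 3 else 4 * q + 3 - i := by
    intro i h hin
    simp only [t]
    split_ifs <;> omega
  have pred_zero : cyclicPred (4 * q + 3) 0 = 4 * q + 2 := rfl
  have pred : ∀ i, 1 ≤ i → cyclicPred (4 * q + 3) i = i - 1 := fun i h => if_neg (by omega)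
  refine ⟨_, hi.isSumLabelling (t := t) (fun i hin => ?_) (fun w hw hw' => ?_) (fun i hin => ?_)
    fun w hw hw' => ?_⟩
  · simp only [t]
    split_ifs <;> omega
  · by_cases h : w ≤ 2 * q + 1
    · refine ⟨2 * w - 1, by omega, ?_⟩
      simp only [t]
      split_ifs <;> omega
    · refine ⟨2 * (4 * q + 3 - w), by omega, ?_⟩
      simp only [t]
      split_ifs <;> omega
  · rcases Nat.eq_zero_or_pos i with rfl | h
    · rw [pred_zero, sum_zero]
      omega
    · rw [pred i h, sum_eq i h hin]
      split_ifs <;> omega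
  · have : w = 2 * q + 1 ∨ ∃ i, 1 ≤ i ∧ i < 4 * q + 3 ∧
        (w = 4 * q + 3 ∧ i = 2 * q + 2 ∨ w ≠ 2 * q + 1 ∧ w ≠ 4 * q + 3 ∧ i = 4 * q + 3 - w) := by
      by_cases h1 : w = 2 * q + 1
      · exact Or.inl h1
      by_cases h2 : w = 4 * q + 3
      · exact Or.inr ⟨2 * q + 2, by omega, by omega, by omega⟩
      · exact Or.inr ⟨4 * q + 3 - w, by omega, by omega, by omega⟩
    obtain rfl | ⟨i, h, hin, h'⟩ := this
    · exact ⟨0, by omega, by rw [pred_zero, sum_zero]⟩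
    · refine ⟨i, hin, ?_⟩
      rw [pred i h, sum_eq i h hin]
      split_ifs <;> omega

/-- Two zigzags give the sums 2q+1, …, 4q-2 and 2, …, 2q-1. The labels 4q, -2q placed between them
give 1, 2q and 4q-1, and the closing edge gives 4q. -/
theorem exists_isSumLabelling_of_four_dvd {ι : Type} {q : ℕ} (hq : 1 ≤ q) {c : Equiv.Perm ι}
    {idx : ι → ℕ} (hi : IsCycleIndex (4 * q) c idx) : ∃ t, IsSumLabelling (4 * q) c t := by
  let t : ℕ → ℤ := fun i =>
    if i = 2 * q - 1 then 4 * q else if i = 2 * q then -(2 * q) else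
    if i < 2 * q then (if i % 2 = 0 then -(3 * q + (i / 2 : ℕ)) else q - 1 - (i / 2 : ℕ))
    else (if i % 2 = 0 then q + (i / 2 : ℕ) else -(3 * q - 1 - (i / 2 : ℕ)))
  have low : ∀ i, i < 2 * q - 1 →
      t i = if i % 2 = 0 then -(3 * q + (i / 2 : ℕ) : ℤ) else q - 1 - (i / 2 : ℕ) := by
    intro i h
    simp only [t]
    rw [if_neg (by omega), if_neg (by omega), if_pos (by omega)]
  have high : ∀ i, 2 * q + 1 ≤ i →
      t i = if i % 2 = 0 then (q + (i / 2 : ℕ) : ℤ) else -(3 * q - 1 - (i / 2 : ℕ)) := by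
    intro i h
    simp only [t]
    rw [if_neg (by omega), if_neg (by omega), if_neg (by omega)]
  have mid : t (2 * q - 1) = 4 * q := if_pos rfl
  have mid' : t (2 * q) = -(2 * q) := by
    simp only [t]
    rw [if_neg (by omega), if_pos trivial]
  have sum_zero : (t 0 + t (4 * q - 1)).natAbs = 4 * q := by
    rw [low 0 (by omega), high _ (by omega), if_pos rfl, if_neg (by omega)]
    omega
  have sum_eq : ∀ i, 1 ≤ i → i < 4 * q → (t i + t (i - 1)).natAbs =
      if i = 2 * q - 1 then 1 else if i = 2 * q then 2 * q else if i = 2 * q + 1 then 4 * q - 1 else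
      if i < 2 * q then 2 * q + i else i - 2 * q := by
    intro i h hin
    obtain h1 | h1 | h1 | h1 | h1 : i < 2 * q - 1 ∨ i = 2 * q - 1 ∨ i = 2 * q ∨
        i = 2 * q + 1 ∨ 2 * q + 2 ≤ i := by omega
    · rw [low i h1, low _ (by omega), if_neg (show ¬ i = 2 * q - 1 by omega),
        if_neg (show ¬ i = 2 * q by omega), if_neg (show ¬ i = 2 * q + 1 by omega),
        if_pos (show i < 2 * q by omega)]
      split_ifs <;> omega
    · rw [if_pos h1, h1, mid, low _ (by omega), if_pos (by omega)]
      omega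
    · rw [if_neg (by omega), if_pos h1, h1, mid, mid']
      omega
    · rw [if_neg (by omega), if_neg (by omega), if_pos h1, h1, Nat.add_sub_cancel, mid',
        high _ le_rfl, if_neg (by omega)]
      omega
    · rw [high i (by omega), high _ (by omega), if_neg (show ¬ i = 2 * q - 1 by omega),
        if_neg (show ¬ i = 2 * q by omega), if_neg (show ¬ i = 2 * q + 1 by omega),
        if_neg (show ¬ i < 2 * q by omega)]
      split_ifs <;> omega
  have pred_zero : cyclicPred (4 * q) 0 = 4 * q - 1 := rfl
  have pred : ∀ i, 1 ≤ i → cyclicPred (4 * q) i = i - 1 := fun i h => if_neg (by omega)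
  refine ⟨_, hi.isSumLabelling (t := t) (fun i hin => ?_) (fun w hw hw' => ?_) (fun i hin => ?_)
    fun w hw hw' => ?_⟩
  · simp only [t]
    split_ifs <;> omega
  · have : ∃ i < 4 * q, w = 4 * q ∧ i = 2 * q - 1 ∨ w = 2 * q ∧ i = 2 * q ∨
        w < q ∧ i = 2 * (q - 1 - w) + 1 ∨ q ≤ w ∧ w < 2 * q ∧ i = 2 * (3 * q - 1 - w) + 1 ∨
        2 * q < w ∧ w < 3 * q ∧ i = 2 * (w - q) ∨
        3 * q ≤ w ∧ w < 4 * q ∧ i = 2 * (w - 3 * q) := by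
      by_cases e1 : w = 4 * q
      · exact ⟨2 * q - 1, by omega, by omega⟩
      by_cases e2 : w = 2 * q
      · exact ⟨2 * q, by omega, by omega⟩
      by_cases e3 : w < q
      · exact ⟨2 * (q - 1 - w) + 1, by omega, by omega⟩
      by_cases e4 : w < 2 * q
      · exact ⟨2 * (3 * q - 1 - w) + 1, by omega, by omega⟩
      by_cases e5 : w < 3 * q
      · exact ⟨2 * (w - q), by omega, by omega⟩
      · exact ⟨2 * (w - 3 * q), by omega, by omega⟩
    obtain ⟨i, hin, h⟩ := this
    refine ⟨i, hin, ?_⟩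
    simp only [t]
    split_ifs <;> omega
  · rcases Nat.eq_zero_or_pos i with rfl | h
    · rw [pred_zero, sum_zero]
      omega
    · rw [pred i h, sum_eq i h hin]
      split_ifs <;> omega
  · have : w = 4 * q ∨ ∃ i, 1 ≤ i ∧ i < 4 * q ∧ (w = 1 ∧ i = 2 * q - 1 ∨
        2 ≤ w ∧ w < 2 * q ∧ i = 2 * q + w ∨ w = 2 * q ∧ i = 2 * q ∨
        2 * q < w ∧ w < 4 * q - 1 ∧ i = w - 2 * q ∨ w = 4 * q - 1 ∧ i = 2 * q + 1) := by
      by_cases e0 : w = 4 * q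
      · exact Or.inl e0
      by_cases e1 : w = 1
      · exact Or.inr ⟨2 * q - 1, by omega, by omega, by omega⟩
      by_cases e2 : w < 2 * q
      · exact Or.inr ⟨2 * q + w, by omega, by omega, by omega⟩
      by_cases e3 : w = 2 * q
      · exact Or.inr ⟨2 * q, by omega, by omega, by omega⟩
      by_cases e4 : w < 4 * q - 1
      · exact Or.inr ⟨w - 2 * q, by omega, by omega, by omega⟩
      · exact Or.inr ⟨2 * q + 1, by omega, by omega, by omega⟩
    obtain rfl | ⟨i, h, hin, h'⟩ := this
    · exact ⟨0, by omega, by rw [pred_zero, sum_zero]⟩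
    · refine ⟨i, hin, ?_⟩
      rw [pred i h, sum_eq i h hin]
      split_ifs <;> omega

theorem IsCycleIndex.isSumLabellingPair {ι : Type} {n : ℕ} {c : Equiv.Perm ι} {idx : ι → ℕ}
    (hi : IsCycleIndex n c idx) {t r : ℕ → ℤ}
    (h1 : ∀ i < n, 1 ≤ (t i).natAbs ∧ (t i).natAbs ≤ n)
    (h2 : ∀ w, 1 ≤ w → w ≤ n → ∃ i < n, (t i).natAbs = w)
    (h3 : ∀ i < n, 1 ≤ (r i).natAbs ∧ (r i).natAbs ≤ n)
    (h4 : ∀ w, 1 ≤ w → w ≤ n → ∃ i < n, (r i).natAbs = w)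
    (h5 : ∀ i < n, 1 ≤ (t i + t (cyclicPred n i) + r i +
      r (cyclicPred n (cyclicPred n i))).natAbs ∧
      (t i + t (cyclicPred n i) + r i + r (cyclicPred n (cyclicPred n i))).natAbs ≤ n)
    (h6 : ∀ w, 1 ≤ w → w ≤ n → ∃ i < n, (t i + t (cyclicPred n i) + r i +
      r (cyclicPred n (cyclicPred n i))).natAbs = w) :
    IsSumLabellingPair n c (fun x => t (idx x)) fun x => r (idx x) where
  left_mem x := h1 _ (hi.lt x)
  left_surj w hw hw' := by
    obtain ⟨i, hin, h⟩ := h2 w hw hw'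
    obtain ⟨x, rfl⟩ := hi.surj i hin
    exact ⟨x, h⟩
  right_mem x := h3 _ (hi.lt x)
  right_surj w hw hw' := by
    obtain ⟨i, hin, h⟩ := h4 w hw hw'
    obtain ⟨x, rfl⟩ := hi.surj i hin
    exact ⟨x, h⟩
  sum_mem x := by simpa only [hi.symm] using h5 _ (hi.lt x)
  sum_surj w hw hw' := by
    obtain ⟨i, hin, h⟩ := h6 w hw hw'
    obtain ⟨x, rfl⟩ := hi.surj i hin
    exact ⟨x, by simpa only [hi.symm] using h⟩

/-- For i ≥ 2, t i + t (i-1) is nearly constant, while r i + r (i-2) is i+1 or 8q+8-i by the parity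
of i. Up to i = 2q+2 the total sums are the even numbers 2q, …, 4q and the odd numbers 2q+3, …,
4q+1; after i = 2q+3 they are 2q-1, …, 1. The positions i = 1, 2q+3 and 0 supply 2q+1, 4q+2 and
4q+3. -/
theorem exists_isSumLabellingPair {ι : Type} {q : ℕ} (hq : 1 ≤ q) {c : Equiv.Perm ι}
    {idx : ι → ℕ} (hi : IsCycleIndex (4 * q + 3) c idx) :
    ∃ t r, IsSumLabellingPair (4 * q + 3) c t r := by
  let t : ℕ → ℤ := fun i =>
    if i < 2 * q + 3 then (if i % 2 = 0 then -(3 * q + 3 - (i / 2 : ℕ)) else -(q + 1 + (i / 2 : ℕ)))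
    else (if i % 2 = 0 then -(5 * q + 5 - (i / 2 : ℕ)) else -((i / 2 : ℕ) - q))
  let r : ℕ → ℤ := fun i => if i % 2 = 0 then (i / 2 : ℕ) + 1 else 4 * q + 3 - (i / 2 : ℕ)
  have sum_zero : (t 0 + t (4 * q + 2) + r 0 + r (4 * q + 1)).natAbs = 4 * q + 3 := by
    have e1 : t 0 = -(3 * q + 3) := by simp [t]
    have e2 : r 0 = 1 := by simp [r]
    have e3 : t (4 * q + 2) = -(3 * q + 4) := by
      simp only [t]
      split_ifs <;> omega
    have e4 : r (4 * q + 1) = 2 * q + 3 := by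
      simp only [r]
      split_ifs <;> omega
    rw [e1, e2, e3, e4]
    omega
  have sum_one : (t 1 + t 0 + r 1 + r (4 * q + 2)).natAbs = 2 * q + 1 := by
    have e1 : t 0 = -(3 * q + 3) := by simp [t]
    have e2 : t 1 = -(q + 1) := by simp [t]
    have e3 : r 1 = 4 * q + 3 := by simp [r]
    have e4 : r (4 * q + 2) = 2 * q + 2 := by
      simp only [r]
      split_ifs <;> omega
    rw [e1, e2, e3, e4]
    omega
  have sum_eq : ∀ i, 2 ≤ i → i < 4 * q + 3 → (t i + t (i - 1) + r i + r (i - 2)).natAbs =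
      if i = 2 * q + 3 then 4 * q + 2 else if 2 * q + 3 < i then 4 * q + 3 - i else
      if i % 2 = 0 then 4 * q + 2 - i else 4 * q + 4 - i := by
    intro i h2 hin
    have hr : r i + r (i - 2) = if i % 2 = 0 then (i : ℤ) + 1 else 8 * q + 8 - i := by
      simp only [r]
      split_ifs <;> omega
    have ht : t i + t (i - 1) = if i = 2 * q + 3 then -(2 * q + 3 : ℤ) else
        if 2 * q + 3 < i then -(4 * q + 4 : ℤ) + (if i % 2 = 0 then 0 else -1 : ℤ) else
        -(4 * q + 3 : ℤ) + (if i % 2 = 0 then 0 else -1 : ℤ) := by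
      simp only [t]
      split_ifs <;> omega
    rw [show t i + t (i - 1) + r i + r (i - 2) = (t i + t (i - 1)) + (r i + r (i - 2)) by ring,
      hr, ht]
    split_ifs <;> omega
  have pred_zero : cyclicPred (4 * q + 3) 0 = 4 * q + 2 ∧
      cyclicPred (4 * q + 3) (4 * q + 2) = 4 * q + 1 := by
    constructor
    · simp [cyclicPred]
    · rw [cyclicPred, if_neg (by omega)]
      omega
  have pred_one : cyclicPred (4 * q + 3) 1 = 0 := by simp [cyclicPred]
  have pred : ∀ i, 2 ≤ i → cyclicPred (4 * q + 3) i = i - 1 ∧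
      cyclicPred (4 * q + 3) (i - 1) = i - 2 := by
    intro i h2
    simp only [cyclicPred]
    split_ifs <;> omega
  refine ⟨_, _, hi.isSumLabellingPair (t := t) (r := r) (fun i hin => ?_) (fun w hw hw' => ?_)
    (fun i hin => ?_) (fun w hw hw' => ?_) (fun i hin => ?_) fun w hw hw' => ?_⟩
  · simp only [t]
    split_ifs <;> omega
  · have : ∃ i < 4 * q + 3, w ≤ q ∧ i = 2 * (w + q) + 1 ∨
        q < w ∧ w ≤ 2 * q + 1 ∧ i = 2 * (w - q - 1) + 1 ∨
        2 * q + 2 ≤ w ∧ w ≤ 3 * q + 3 ∧ i = 2 * (3 * q + 3 - w) ∨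
        3 * q + 4 ≤ w ∧ i = 2 * (5 * q + 5 - w) := by
      by_cases e1 : w ≤ q
      · exact ⟨2 * (w + q) + 1, by omega, by omega⟩
      by_cases e2 : w ≤ 2 * q + 1
      · exact ⟨2 * (w - q - 1) + 1, by omega, by omega⟩
      by_cases e3 : w ≤ 3 * q + 3
      · exact ⟨2 * (3 * q + 3 - w), by omega, by omega⟩
      · exact ⟨2 * (5 * q + 5 - w), by omega, by omega⟩
    obtain ⟨i, hin, h⟩ := this
    refine ⟨i, hin, ?_⟩
    simp only [t]
    split_ifs <;> omega
  · simp only [r]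
    split_ifs <;> omega
  · by_cases h : w ≤ 2 * q + 2
    · refine ⟨2 * (w - 1), by omega, ?_⟩
      simp only [r]
      split_ifs <;> omega
    · refine ⟨2 * (4 * q + 3 - w) + 1, by omega, ?_⟩
      simp only [r]
      split_ifs <;> omega
  · obtain rfl | rfl | h2 : i = 0 ∨ i = 1 ∨ 2 ≤ i := by omega
    · rw [pred_zero.1, pred_zero.2, sum_zero]
      omega
    · rw [pred_one, pred_zero.1, sum_one]
      omega
    · rw [(pred i h2).1, (pred i h2).2, sum_eq i h2 hin]
      split_ifs <;> omega
  · by_cases e1 : w = 4 * q + 3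
    · refine ⟨0, by omega, ?_⟩
      rw [pred_zero.1, pred_zero.2, sum_zero, e1]
    by_cases e2 : w = 2 * q + 1
    · refine ⟨1, by omega, ?_⟩
      rw [pred_one, pred_zero.1, sum_one, e2]
    have : ∃ i, 2 ≤ i ∧ i < 4 * q + 3 ∧ (w = 4 * q + 2 ∧ i = 2 * q + 3 ∨
        w < 2 * q ∧ i = 4 * q + 3 - w ∨
        2 * q ≤ w ∧ w < 4 * q + 2 ∧ w % 2 = 0 ∧ i = 4 * q + 2 - w ∨
        2 * q + 1 < w ∧ w < 4 * q + 2 ∧ w % 2 = 1 ∧ i = 4 * q + 4 - w) := by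
      by_cases h1 : w = 4 * q + 2
      · exact ⟨2 * q + 3, by omega, by omega, by omega⟩
      by_cases h2 : w < 2 * q
      · exact ⟨4 * q + 3 - w, by omega, by omega, by omega⟩
      by_cases h3 : w % 2 = 0
      · exact ⟨4 * q + 2 - w, by omega, by omega, by omega⟩
      · exact ⟨4 * q + 4 - w, by omega, by omega, by omega⟩
    obtain ⟨i, h2, hin, h⟩ := this
    refine ⟨i, hin, ?_⟩
    rw [(pred i h2).1, (pred i h2).2, sum_eq i h2 hin]
    split_ifs <;> omega

/-! ### Existence, by residues of k and n modulo 4. -/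

theorem existsIntegerHeffter_of_four_dvd {n k : ℕ} (hk : 1 ≤ k) (hkn : k ≤ n) (h : 4 ∣ k) :
    ExistsIntegerHeffter k n k := by
  have : NeZero n := ⟨by omega⟩
  obtain ⟨j, rfl⟩ := h
  refine existsIntegerHeffter_of_cyclicPerm hk hkn ?_
  have h0 : Realizes 0 (cyclicPerm n) (halves n (Set.Iio 0)) := by
    have : halves n (Set.Iio 0) = ∅ := by simp [halves]
    rw [this]
    exact Realizes.zero
  simpa using h0.cyclicPerm_add_four_mul j

theorem cyclicPerm_zero_apply (n : ℕ) (x : ZMod n) : cyclicPerm n 0 x = x := by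
  simp [cyclicPerm]

theorem cyclicPerm_succ_apply (n p : ℕ) (x : ZMod n) :
    cyclicPerm n (p + 1) x = cyclicPerm n 1 (cyclicPerm n p x) := by
  simp [cyclicPerm, add_assoc]

theorem exists_isSumLabelling {ι : Type} {n : ℕ} (hn : n % 4 = 0 ∨ n % 4 = 3) (hn0 : 1 ≤ n)
    {c : Equiv.Perm ι} {idx : ι → ℕ} (hi : IsCycleIndex n c idx) :
    ∃ t, IsSumLabelling n c t := by
  rcases hn with hn | hn
  · obtain ⟨q, rfl⟩ : ∃ q, n = 4 * q := ⟨n / 4, by omega⟩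
    exact exists_isSumLabelling_of_four_dvd (by omega) hi
  · obtain ⟨q, rfl⟩ : ∃ q, n = 4 * q + 3 := ⟨n / 4, by omega⟩
    exact exists_isSumLabelling_of_mod_four_eq_three hi

theorem existsIntegerHeffter_of_mod_four_eq_three {n k : ℕ} (hkn : k ≤ n) (hk : k % 4 = 3)
    (hn : n % 4 = 0 ∨ n % 4 = 3) : ExistsIntegerHeffter k n k := by
  have : NeZero n := ⟨by omega⟩
  obtain ⟨t, ht⟩ := exists_isSumLabelling hn (by omega) (isCycleIndex_cyclicPerm n)
  have h3 := ht.realizes (cyclicPerm_zero_apply n) (cyclicPerm_succ_apply n)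
  refine existsIntegerHeffter_of_cyclicPerm (by omega) hkn ?_
  have := h3.cyclicPerm_add_four_mul (k / 4)
  rwa [show 3 + 4 * (k / 4) = k by omega] at this

theorem existsIntegerHeffter_of_mod_four_eq_one {n k : ℕ} (h5 : 5 ≤ k) (hkn : k ≤ n)
    (hk : k % 4 = 1) (hn : n % 4 = 3) : ExistsIntegerHeffter k n k := by
  have : NeZero n := ⟨by omega⟩
  obtain ⟨t, r, ht⟩ : ∃ t r, IsSumLabellingPair n (cyclicPerm n 1) t r := by
    obtain ⟨q, rfl⟩ : ∃ q, n = 4 * q + 3 := ⟨n / 4, by omega⟩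
    exact exists_isSumLabellingPair (by omega) (isCycleIndex_cyclicPerm _)
  have h := ht.realizes (cyclicPerm_zero_apply n) (cyclicPerm_succ_apply n)
  refine existsIntegerHeffter_of_cyclicPerm (by omega) hkn ?_
  have := h.cyclicPerm_add_four_mul ((k - 5) / 4)
  rwa [show 5 + 4 * ((k - 5) / 4) = k by omega] at this

/-- The offset 2a is even so that the new diagonals again pair up into whole 2 × 2 blocks. -/
theorem Realizes.add_four_of_blockPerm {m k a : ℕ} [NeZero m]
    {σ : ℕ → Equiv.Perm (ZMod m × ZMod 2)} (h : Realizes k σ (halves (2 * m) (Set.Iio k)))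
    (hσ : ∀ p, σ (k + p) = blockPerm m (2 * a + p)) :
    Realizes (k + 4) σ (halves (2 * m) (Set.Iio (k + 4))) := by
  have h4 := ((realizes_blockPerm_four m k).trans_right (blockPerm m (2 * a))).congr
    (τ := fun p => σ (k + p)) fun p _ => by rw [hσ, blockPerm_two_mul_add]
  rw [← Set.Iio_union_Ico_eq_Iio (show k ≤ k + 4 by omega), halves_union]
  exact h.append h4

theorem add_natCast_inj {m a b : ℕ} {x : ZMod m} (ha : a < m) (hb : b < m)
    (h : x + (a : ZMod m) = x + b) : a = b := by
  rwa [add_right_inj, ZMod.natCast_eq_natCast_iff', Nat.mod_eq_of_lt ha, Nat.mod_eq_of_lt hb] at h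

theorem blockPerm_inj {m p q : ℕ} (hp : p < 2 * m) (hq : q < 2 * m) {x : ZMod m × ZMod 2}
    (h : blockPerm m p x = blockPerm m q x) : p = q := by
  simp only [blockPerm, Equiv.coe_addRight, Prod.ext_iff, Prod.fst_add, Prod.snd_add] at h
  have h1 := add_natCast_inj (by omega) (by omega) h.1
  have h2 := h.2
  rw [add_right_inj, ZMod.natCast_eq_natCast_iff'] at h2
  omega

theorem card_zmod_prod (m : ℕ) [NeZero m] : Fintype.card (ZMod m × ZMod 2) = 2 * m := by
  rw [Fintype.card_prod, ZMod.card, ZMod.card, mul_comm]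

theorem existsIntegerHeffter_of_mod_four_eq_two {n k : ℕ} (h6 : 6 ≤ k) (hkn : k ≤ n)
    (hk : k % 4 = 2) (hn : n % 2 = 0) : ExistsIntegerHeffter k n k := by
  obtain ⟨m, rfl⟩ : ∃ m, n = 2 * m := ⟨n / 2, by omega⟩
  have : NeZero m := ⟨by omega⟩
  have key : ∀ j, Realizes (6 + 4 * j) (blockPerm m)
      (halves (2 * m) (Set.Iio (6 + 4 * j))) := by
    intro j
    induction j with
    | zero => exact realizes_blockPerm_six (by omega)
    | succ j ih =>
      exact ih.add_four_of_blockPerm (a := 3 + 2 * j) fun p => by congr 1; ring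
  have := key ((k - 6) / 4)
  rw [show 6 + 4 * ((k - 6) / 4) = k by omega] at this
  exact existsIntegerHeffter_of_realizes (by omega) (card_zmod_prod m) this
    fun x p hp q hq h => blockPerm_inj (by omega) (by omega) h

/-- Three steps along `blockCycle`, followed by translations. -/
def cycleBlockPerm (m p : ℕ) : Equiv.Perm (ZMod m × ZMod 2) :=
  if p < 3 then blockCycle m ^ p else blockPerm m (p + 1)

theorem cycleBlockPerm_of_lt {m p : ℕ} (hp : p < 3) (x : ZMod m × ZMod 2) :
    ∃ a : ℕ, cycleBlockPerm m p x = (x.1 + a, x.2 + p) ∧ p / 2 ≤ a ∧ a ≤ (p + 1) / 2 := by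
  obtain ⟨i, b⟩ := x
  obtain rfl | rfl : b = 0 ∨ b = 1 := by revert b; decide
  · obtain rfl | rfl | rfl : p = 0 ∨ p = 1 ∨ p = 2 := by omega
    · exact ⟨0, by simp [cycleBlockPerm], by simp, by simp⟩
    · exact ⟨0, by simp [cycleBlockPerm, blockCycle_apply], by simp, by simp⟩
    · refine ⟨1, ?_, by simp, by simp⟩
      simp [cycleBlockPerm, blockCycle_apply, pow_succ]
      rfl
  · obtain rfl | rfl | rfl : p = 0 ∨ p = 1 ∨ p = 2 := by omega
    · exact ⟨0, by simp [cycleBlockPerm], by simp, by simp⟩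
    · refine ⟨1, ?_, by simp, by simp⟩
      simp [cycleBlockPerm, blockCycle_apply]
      rfl
    · refine ⟨1, ?_, by simp, by simp⟩
      simp [cycleBlockPerm, blockCycle_apply, pow_succ]
      rfl

/-- Along the cycle the block offset a depends on the parity of the row. The bounds on a, together
with the parity of b, are still enough to separate the diagonals. -/
theorem cycleBlockPerm_apply {m p : ℕ} (x : ZMod m × ZMod 2) :
    ∃ a b : ℕ, cycleBlockPerm m p x = (x.1 + a, x.2 + b) ∧
      (p < 3 ∧ b = p ∧ p / 2 ≤ a ∧ a ≤ (p + 1) / 2 ∨ 3 ≤ p ∧ b = p + 1 ∧ a = (p + 1) / 2) := by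
  rcases Nat.lt_or_ge p 3 with hp | hp
  · obtain ⟨a, h, ha⟩ := cycleBlockPerm_of_lt hp x
    exact ⟨a, p, h, Or.inl ⟨hp, rfl, ha⟩⟩
  · refine ⟨(p + 1) / 2, p + 1, ?_, Or.inr ⟨hp, rfl, rfl⟩⟩
    rw [cycleBlockPerm, if_neg (by omega)]
    rfl

theorem cycleBlockPerm_inj {m p q : ℕ} (hp : p + 1 < 2 * m) (hq : q + 1 < 2 * m)
    {x : ZMod m × ZMod 2} (h : cycleBlockPerm m p x = cycleBlockPerm m q x) : p = q := by
  obtain ⟨a, b, h1, h2⟩ := cycleBlockPerm_apply (p := p) x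
  obtain ⟨a', b', h1', h2'⟩ := cycleBlockPerm_apply (p := q) x
  rw [h1, h1', Prod.ext_iff] at h
  have e1 := add_natCast_inj (by omega) (by omega) h.1
  have e2 := h.2
  simp only [add_right_inj, ZMod.natCast_eq_natCast_iff'] at e2
  omega

/-- The three cycle diagonals stay within block offsets 0 and 1, so the blocks may start at offset
2. One translation index is skipped, which is harmless as k < n by the congruences. -/
theorem existsIntegerHeffter_of_mod_four_eq_one_of_four_dvd {n k : ℕ} (h9 : 9 ≤ k) (hkn : k ≤ n)
    (hk : k % 4 = 1) (hn : n % 4 = 0) : ExistsIntegerHeffter k n k := by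
  obtain ⟨h, rfl⟩ : ∃ h, n = 2 * (2 * h) := ⟨n / 4, by omega⟩
  have : NeZero (2 * h) := ⟨by omega⟩
  obtain ⟨t, ht⟩ := exists_isSumLabelling (Or.inl hn) (by omega) (isCycleIndex_blockCycle (2 * h))
  have h3 : Realizes 3 (cycleBlockPerm (2 * h)) (halves (2 * (2 * h)) (Set.Iio 3)) :=
    (ht.realizes (σ := fun p => blockCycle (2 * h) ^ p) (fun x => rfl)
      fun p x => by rw [pow_succ', Equiv.Perm.mul_apply]).congr
      fun p hp => by rw [cycleBlockPerm, if_pos hp]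
  have hσ : ∀ p a b, 3 ≤ p → p + 1 = 2 * a + b →
      cycleBlockPerm (2 * h) p = blockPerm (2 * h) (2 * a + b) := by
    intro p a b hp hab
    rw [cycleBlockPerm, if_neg (by omega), hab]
  have key : ∀ j, Realizes (9 + 4 * j) (cycleBlockPerm (2 * h))
      (halves (2 * (2 * h)) (Set.Iio (9 + 4 * j))) := by
    intro j
    induction j with
    | zero =>
      have h6 := ((realizes_blockPerm_six_from_three (h := h) (by omega)).trans_right
        (blockPerm (2 * h) (2 * 2))).congr (τ := fun p => cycleBlockPerm (2 * h) (3 + p))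
        fun p _ => by rw [hσ (3 + p) 2 p (by omega) (by omega), blockPerm_two_mul_add]
      rw [show 4 * h = 2 * (2 * h) by ring] at h6
      have := h3.append h6
      rwa [← halves_union, Set.Iio_union_Ico_eq_Iio (by omega)] at this
    | succ j ih =>
      exact ih.add_four_of_blockPerm (a := 5 + 2 * j) fun p =>
        hσ _ _ _ (by omega) (by omega)
  have := key ((k - 9) / 4)
  rw [show 9 + 4 * ((k - 9) / 4) = k by omega] at this
  exact existsIntegerHeffter_of_realizes (by omega) (card_zmod_prod _) this
    fun x p hp q hq h => cycleBlockPerm_inj (by omega) (by omega) h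

/-! ### Necessity: the parity of the sum of the half blocks. -/

theorem halfStart_add_le (n j : ℕ) : halfStart n j + n ≤ halfStart n (j + 1) := by
  unfold halfStart
  obtain ⟨q, rfl | rfl⟩ := j.even_or_odd'
  · rw [show 2 * q / 2 = q by omega, show (2 * q + 1) / 2 = q by omega,
      show 2 * q % 2 = 0 by omega, show (2 * q + 1) % 2 = 1 by omega]
    omega
  · rw [show (2 * q + 1) / 2 = q by omega, show (2 * q + 1 + 1) / 2 = q + 1 by omega,
      show (2 * q + 1) % 2 = 1 by omega, show (2 * q + 1 + 1) % 2 = 0 by omega, add_mul]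
    omega

theorem halfStart_add_injOn (n k : ℕ) : Set.InjOn (fun c : ℕ × ℕ => halfStart n c.1 + c.2)
    (Finset.range k ×ˢ Finset.range n : Finset (ℕ × ℕ)) := by
  have mono : Monotone (halfStart n) :=
    monotone_nat_of_le_succ fun j => (Nat.le_add_right _ _).trans (halfStart_add_le n j)
  have lt : ∀ {j j' : ℕ}, j < j' → halfStart n j + n ≤ halfStart n j' := fun h =>
    (halfStart_add_le n _).trans (mono h)
  rintro ⟨j, v⟩ hv ⟨j', v'⟩ hv' h
  simp only [Finset.coe_product, Set.mem_prod, Finset.coe_range, Set.mem_Iio] at hv hv' h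
  rcases lt_trichotomy j j' with h1 | rfl | h1
  · have := lt h1
    omega
  · rw [Prod.mk.injEq]
    omega
  · have := lt h1
    omega

/-- The sum of the first `k` half blocks. -/
def halvesSum (n k : ℕ) : ℕ := ∑ j ∈ Finset.range k, ∑ v ∈ Finset.range n, (halfStart n j + v)

theorem halvesSum_succ (n k : ℕ) :
    halvesSum n (k + 1) = halvesSum n k + (n * halfStart n k + ∑ v ∈ Finset.range n, v) := by
  rw [halvesSum, Finset.sum_range_succ, ← halvesSum, Finset.sum_add_distrib, Finset.sum_const,
    Finset.card_range, smul_eq_mul]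

theorem halfStart_two_mul (n q : ℕ) : halfStart n (2 * q) = q * (2 * n + 1) + 1 := by
  rw [halfStart, show 2 * q / 2 = q by omega, show 2 * q % 2 = 0 by omega]
  omega

theorem halfStart_two_mul_add_one (n q : ℕ) :
    halfStart n (2 * q + 1) = q * (2 * n + 1) + n + 1 := by
  rw [halfStart, show (2 * q + 1) / 2 = q by omega, show (2 * q + 1) % 2 = 1 by omega]
  omega

/-- The 2n numbers q(2n+1) + 1, …, q(2n+1) + 2n have sum 2nq(2n+1) + n(2n+1), which is ≡ n mod 2. -/
theorem exists_halvesSum_two_mul (n q : ℕ) : ∃ c, halvesSum n (2 * q) = 2 * c + n * q := by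
  induction q with
  | zero => exact ⟨0, by simp [halvesSum]⟩
  | succ q ih =>
    obtain ⟨c, hc⟩ := ih
    have h1 : (∑ v ∈ Finset.range n, v) * 2 + n = n * n := by
      rw [Finset.sum_range_id_mul_two]
      cases n with
      | zero => rfl
      | succ n => rw [Nat.add_sub_cancel]; ring
    refine ⟨c + n * (q * (2 * n + 1) + n), ?_⟩
    rw [mul_add, mul_one, halvesSum_succ, halvesSum_succ, hc, halfStart_two_mul,
      halfStart_two_mul_add_one]
    nlinarith

theorem even_halvesSum {n k : ℕ} (hk : 1 ≤ k) (h : ExistsIntegerHeffter k n k) :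
    Even (halvesSum n k) := by
  obtain ⟨A, hA⟩ := h
  let g : Fin n × Fin n → ℕ := fun c => ((A c.1 c.2).getD 0).natAbs
  let F : Finset (Fin n × Fin n) := Finset.univ.filter fun c => (A c.1 c.2).isSome
  let P : Finset ℕ := (Finset.range k ×ˢ Finset.range n).image fun c => halfStart n c.1 + c.2
  have hF : F.card = k * n := by
    have h1 : ∀ i, A.rowCount i = k := fun i => by
      rw [← PFArray.rowCount_toZMod A (2 * n * k + k)]
      exact hA.isRelativeHeffter.row_count i
    calc F.card = ∑ i, A.rowCount i := by
          simp only [F, Finset.card_filter, PFArray.rowCount, Fintype.sum_prod_type]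
      _ = k * n := by simp [h1, mul_comm]
  have hP : P.card = k * n := by
    rw [Finset.card_image_of_injOn (halfStart_add_injOn n k), Finset.card_product,
      Finset.card_range, Finset.card_range]
  have hsub : P ⊆ F.image g := by
    intro x hx
    have hx' : x ∈ halves n (Set.Iio k) := by
      obtain ⟨⟨j, v⟩, hjv, rfl⟩ := Finset.mem_image.1 hx
      rw [Finset.mem_product, Finset.mem_range, Finset.mem_range] at hjv
      exact ⟨j, hjv.1, v, hjv.2, rfl⟩
    have hle := le_of_mem_halves hx'
    have happ := hA.isRelativeHeffter.covers x
      ((cast_mem_subgroupOfOrder_iff hk x).not.2 (not_dvd_of_mem_halves hx'))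
    have key : ∃ a, A.Appears a ∧ a.natAbs = x := by
      rw [PFArray.appears_toZMod, PFArray.appears_toZMod] at happ
      rcases happ with ⟨a, ha, hax⟩ | ⟨a, ha, hax⟩
      all_goals
        refine ⟨a, ha, ?_⟩
        -- Both |a| and x are at most v/2, so a ≡ ±x mod v already gives |a| = x.
        have hb := (hA.entry_mem a ha).2
        rw [Int.abs_eq_natAbs] at hb
      · have h1 : ((a - x : ℤ) : ZMod (2 * n * k + k)) = 0 := by
          push_cast
          rw [hax, sub_self]
        rw [ZMod.intCast_zmod_eq_zero_iff_dvd] at h1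
        obtain ⟨c, hc⟩ := h1
        have : c = 0 ∨ 1 ≤ c ∨ c ≤ -1 := by omega
        rcases this with rfl | h1 | h1
        · omega
        · have : ((2 * n * k + k : ℕ) : ℤ) ≤ (2 * n * k + k : ℕ) * c := by nlinarith
          omega
        · have : ((2 * n * k + k : ℕ) : ℤ) * c ≤ -(2 * n * k + k : ℕ) := by nlinarith
          omega
      · have h1 : ((a + x : ℤ) : ZMod (2 * n * k + k)) = 0 := by
          push_cast
          rw [hax, neg_add_cancel]
        rw [ZMod.intCast_zmod_eq_zero_iff_dvd] at h1
        obtain ⟨c, hc⟩ := h1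
        have : c = 0 ∨ 1 ≤ c ∨ c ≤ -1 := by omega
        rcases this with rfl | h1 | h1
        · omega
        · have : ((2 * n * k + k : ℕ) : ℤ) ≤ (2 * n * k + k : ℕ) * c := by nlinarith
          omega
        · have : ((2 * n * k + k : ℕ) : ℤ) * c ≤ -(2 * n * k + k : ℕ) := by nlinarith
          omega
    obtain ⟨a, ⟨i, j, hij⟩, rfl⟩ := key
    exact Finset.mem_image.2 ⟨(i, j), by simp [F, hij], by simp [g, hij]⟩
  -- The filled cells number kn, as many as the elements of the half blocks, so covering them leaves
  -- no room for other values or repetitions.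
  have heq : P = F.image g :=
    Finset.eq_of_subset_of_card_le hsub (Finset.card_image_le.trans (hF.trans hP.symm).le)
  have hinj : Set.InjOn g F := Finset.card_image_iff.1 (by rw [← heq, hP, hF])
  have hsum : halvesSum n k = ∑ c, g c := by
    calc halvesSum n k = ∑ x ∈ P, x := by
          rw [Finset.sum_image (halfStart_add_injOn n k), Finset.sum_product, halvesSum]
      _ = ∑ c ∈ F, g c := by rw [heq, Finset.sum_image hinj]
      _ = ∑ c, g c := by
          refine Finset.sum_filter_of_ne fun c _ hc => ?_
          by_contra hn
          rw [Option.not_isSome_iff_eq_none] at hn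
          simp [g, hn] at hc
  have hzero : ∑ c : Fin n × Fin n, (A c.1 c.2).getD 0 = 0 := by
    rw [Fintype.sum_prod_type]
    exact Finset.sum_eq_zero fun i _ => hA.row_sum i
  have : Even ((∑ c, g c : ℕ) : ℤ) := by
    rw [Nat.cast_sum, ← sub_zero (∑ c, (g c : ℤ)), ← hzero, ← Finset.sum_sub_distrib]
    -- Each |a| - a is even.
    refine Finset.even_sum _ fun c _ => ?_
    rw [Int.even_iff]
    simp only [g]
    omega
  rw [hsum]
  exact_mod_cast this

theorem mod_four_of_odd {n k : ℕ} (hk : Odd k) (h : ExistsIntegerHeffter k n k) :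
    n % 4 = 0 ∨ n % 4 = 3 := by
  have he := even_halvesSum hk.pos h
  obtain ⟨q, rfl⟩ := hk
  obtain ⟨c, hc⟩ := exists_halvesSum_two_mul n q
  rw [halvesSum_succ, hc, halfStart_two_mul] at he
  have h1 := Finset.sum_range_id_mul_two n
  generalize ∑ v ∈ Finset.range n, v = T at *
  have h2 : 2 * c + n * q + (n * (q * (2 * n + 1) + 1) + T) =
      2 * (c + n * q * (n + 1)) + (n + T) := by ring
  -- What remains is that n + T = n(n+1)/2 is even.
  rw [h2, Nat.even_add, iff_true_left (even_two_mul _)] at he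
  obtain ⟨d, hd⟩ := he
  by_contra hn
  obtain ⟨a, ha | ha⟩ : ∃ a, n = 4 * a + 1 ∨ n = 4 * a + 2 := ⟨n / 4, by omega⟩
  · rw [ha, Nat.add_sub_cancel] at h1
    have : T = 2 * (a * (4 * a + 1)) := by linarith
    omega
  · rw [ha, show 4 * a + 2 - 1 = 4 * a + 1 by omega] at h1
    have : T = 2 * (4 * a * a + 3 * a) + 1 := by linarith
    omega

theorem even_of_mod_four_eq_two {n k : ℕ} (hk : k % 4 = 2) (h : ExistsIntegerHeffter k n k) :
    Even n := by
  have he := even_halvesSum (by omega) h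
  obtain ⟨q, rfl⟩ : ∃ q, k = 2 * q := ⟨k / 2, by omega⟩
  obtain ⟨c, hc⟩ := exists_halvesSum_two_mul n q
  rw [hc, Nat.even_add, iff_true_left (even_two_mul _), Nat.even_mul] at he
  exact he.resolve_right (by rw [Nat.even_iff]; omega)

theorem mainTheorem1 :
    (∀ n k : ℕ, 3 ≤ k → k ≤ n → k ≠ 5 →
      (ExistsIntegerHeffter k n k ↔
        (Odd k ∧ (n ≡ 0 [MOD 4] ∨ n ≡ 3 [MOD 4])) ∨
        (k ≡ 2 [MOD 4] ∧ Even n) ∨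
        k ≡ 0 [MOD 4])) ∧
    (∀ n : ℕ, 5 ≤ n → n ≡ 3 [MOD 4] → ExistsIntegerHeffter 5 n 5) ∧
    (∀ n : ℕ, (n ≡ 1 [MOD 4] ∨ n ≡ 2 [MOD 4]) → ¬ ExistsIntegerHeffter 5 n 5) := by
  simp only [Nat.ModEq, Nat.zero_mod, Nat.one_mod, Nat.reduceMod]
  refine ⟨fun n k h3 hkn h5 => ⟨fun h => ?_, ?_⟩, fun n h5 hn => ?_, fun n hn h => ?_⟩
  · rcases k.even_or_odd with hk | hk
    · rw [Nat.even_iff] at hk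
      rcases (show k % 4 = 0 ∨ k % 4 = 2 by omega) with h4 | h4
      · exact Or.inr (Or.inr h4)
      · exact Or.inr (Or.inl ⟨h4, even_of_mod_four_eq_two h4 h⟩)
    · exact Or.inl ⟨hk, mod_four_of_odd hk h⟩
  · rintro (⟨hk, hn⟩ | ⟨hk, hn⟩ | hk)
    · rw [Nat.odd_iff] at hk
      rcases (show k % 4 = 1 ∨ k % 4 = 3 by omega) with h4 | h4
      · rcases hn with hn | hn
        · exact existsIntegerHeffter_of_mod_four_eq_one_of_four_dvd (by omega) hkn h4 hn
        · exact existsIntegerHeffter_of_mod_four_eq_one (by omega) hkn h4 hn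
      · exact existsIntegerHeffter_of_mod_four_eq_three hkn h4 hn
    · exact existsIntegerHeffter_of_mod_four_eq_two (by omega) hkn hk (Nat.even_iff.1 hn)
    · exact existsIntegerHeffter_of_four_dvd (by omega) hkn (Nat.dvd_of_mod_eq_zero hk)
  · exact existsIntegerHeffter_of_mod_four_eq_one le_rfl h5 rfl hn
  · have := mod_four_of_odd ⟨2, rfl⟩ h
    omega
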